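/- Let $\mathbf{32}$ be the real $32$-dimensional Majorana representation of $\mathrm{Pin}^+(1,10)$, with Clifford generators $\Gamma_0,\dots,\Gamma_{10}$ satisfying $\Gamma_a\Gamma_b+\Gamma_b\Gamma_a=2\eta_{ab}$ for $\eta=\mathrm{diag}(-1,+1,\dots,+1)$ and $\Gamma_0\Gamma_1\cdots\Gamma_{10}=1$, and with a non-degenerate skew-symmetric bilinear pairing $(\overline{\phi}\,\psi)$ for which every $\Gamma_a$ is skew self-adjoint, $(\overline{\Gamma_a\phi}\,\psi)=-(\overline{\phi}\,\Gamma_a\psi)$. Write $\Gamma_{a_1\cdots a_p}:=\tfrac1{p!}\sum_{\sigma}\mathrm{sgn}(\sigma)\,\Gamma_{a_{\sigma(1)}}\cdots\Gamma_{a_{\sigma(p)}}$ and $\Gamma^a:=\eta^{ab}\Gamma_b$. As a $\mathrm{Spin}(1,9)$-representation, $\mathbf{32}=\mathbf{16}\oplus\overline{\mathbf{16}}$, the summands being the images of $\tfrac12(1\pm\Gamma_{10})$. Let $\mathrm{CE}(\mathbb{R}^{1,9|\mathbf{16}\oplus\overline{\mathbf{16}}})$ be the Chevalley--Eilenberg algebra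 of the type IIA super-Minkowski algebra: the $(\mathbb{Z}\times\mathbb{Z}_2)$-graded-commutative real algebra generated by $\psi^\alpha$ ($\alpha=1,\dots,32$) in degree $(1,\mathrm{odd})$ and $e^a$ ($a=0,\dots,9$) in degree $(1,\mathrm{even})$, with sign rule $xy=(-1)^{n_xn_y+\sigma_x\sigma_y}\,yx$ for $\deg x=(n_x,\sigma_x)$, $\deg y=(n_y,\sigma_y)$, and with differential $\mathrm{d}$ the graded derivation of degree $(1,\mathrm{even})$ determined by $$\mathrm{d}\psi^\alpha=0,\qquad \mathrm{d}e^a=(\overline{\psi}\,\Gamma^a\,\psi).$$ With the summation convention, all $a_i$ running over $0,\dots,9$, consider in this algebra $$H_3^A:=(\overline{\psi}\,\Gamma_a\Gamma_{10}\,\psi)\,e^a,\qquad F_6:=\tfrac1{4!}(\overline{\psi}\,\Gamma_{a_1\cdots a_4}\Gamma_{10}\,\psi)\,e^{a_1}\cdots e^{a_4},\qquad F_8:=\tfrac1{6!}(\overline{\psi}\,\Gamma_{a_1\cdots a_6}\,\psi)\,e^{a_1}\cdots e^{a_6},$$ $$F_{10}:=\tfrac1{8!}(\overline{\psi}\,\Gamma_{a_1\cdots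 a_8}\Gamma_{10}\,\psi)\,e^{a_1}\cdots e^{a_8},\qquad F_{12}:=\tfrac1{10!}(\overline{\psi}\,\Gamma_{a_1\cdots a_{10}}\,\psi)\,e^{a_1}\cdots e^{a_{10}}.$$ Then $$\mathrm{d}F_8=H_3^A\,F_6,\qquad \mathrm{d}F_{10}=H_3^A\,F_8,\qquad \mathrm{d}F_{12}=H_3^A\,F_{10},\qquad H_3^A\,F_{12}=0.$$ -/

import Mathlib

noncomputable section

namespace SuperIIA

/-! ## The Majorana spinors in 11 dimensions -/

/-- The mostly-plus Minkowski metric `diag(-1, +1, …, +1)` in dimension `1 + 10`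
(equal to its own inverse). -/
def minkowski (a b : Fin 11) : ℝ :=
  if a = b then (if a = 0 then -1 else 1) else 0

/-- The real 32-dimensional (Majorana) pinor representation `𝟑𝟐` of `Pin⁺(1,10)` together with
its spinor pairing, in components with respect to an arbitrary linear basis of `𝟑𝟐`:
`gamma a` is the matrix `(Γ_a)^α_β` and `pairing` is the matrix `η_{αβ}` with
`(ψ̄ φ) = ψ^α η_{αβ} φ^β`. -/
structure MajoranaRep where
  /-- The Clifford generators `Γ_0, …, Γ_10`. -/
  gamma : Fin 11 → Matrix (Fin 32) (Fin 32) ℝ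
  /-- The spinor metric. -/
  pairing : Matrix (Fin 32) (Fin 32) ℝ
  /-- `Γ_a Γ_b + Γ_b Γ_a = 2 η_{ab}`. -/
  clifford : ∀ a b, gamma a * gamma b + gamma b * gamma a =
    (2 * minkowski a b) • (1 : Matrix (Fin 32) (Fin 32) ℝ)
  /-- `Γ_0 Γ_1 ⋯ Γ_10 = 1`. -/
  volume_eq : (List.ofFn gamma).prod = 1
  /-- The spinor pairing is skew-symmetric. -/
  pairing_skew : pairing.transpose = -pairing
  /-- The spinor pairing is non-degenerate. -/
  pairing_nondegenerate : IsUnit pairing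
  /-- The Clifford generators are skew self-adjoint: `(Γ_a φ)‾ ψ = - φ̄ (Γ_a ψ)`. -/
  gamma_skew_adjoint : ∀ a, (gamma a).transpose * pairing = -(pairing * gamma a)

namespace MajoranaRep

variable (M : MajoranaRep)

/-- The Clifford generators with raised index, `Γ^a = η^{ab} Γ_b`. -/
def gammaUp (a : Fin 11) : Matrix (Fin 32) (Fin 32) ℝ :=
  ∑ b, minkowski a b • M.gamma b

/-- The skew-symmetrized product `Γ_{a_1 ⋯ a_k}` of Clifford generators. -/
def gammaSkew {k : ℕ} (a : Fin k → Fin 11) : Matrix (Fin 32) (Fin 32) ℝ :=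
  ((k.factorial : ℝ)⁻¹) • ∑ σ : Equiv.Perm (Fin k),
    ((Equiv.Perm.sign σ : ℤ) : ℝ) • (List.ofFn fun i => M.gamma (a (σ i))).prod

end MajoranaRep

/-! ## The graded-commutative algebra underlying the Chevalley–Eilenberg algebra -/

/-- The generators `ψ^α` (for `α = 1, …, 32`, the components of `ψ = ψ₁ + ψ₂` in
`𝟑𝟐 = 𝟏𝟔 ⊕ 𝟏𝟔bar`) and `e^a` (for `a = 0, …, 9`). -/
inductive Gen : Type
  | psi (α : Fin 32)
  | e (a : Fin 10)

/-- The bidegree in `ℤ × ℤ/2`: `deg ψ^α = (1, odd)` and `deg e^a = (1, even)`. -/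
def Gen.bideg : Gen → ℤ × ZMod 2
  | .psi _ => (1, 1)
  | .e _ => (1, 0)

/-- The sign `(-1)^(n₁ n₂ + σ₁ σ₂)` of the bigraded sign rule. -/
def bisign (p q : ℤ × ZMod 2) : ℝ :=
  (((p.1 * q.1 + (p.2.val : ℤ) * (q.2.val : ℤ)).negOnePow : ℤˣ) : ℤ)

/-- The bigraded sign rule `x y = (-1)^(n₁ n₂ + σ₁ σ₂) y x` on generators. -/
inductive SignRule : FreeAlgebra ℝ Gen → FreeAlgebra ℝ Gen → Prop
  | swap (x y : Gen) : SignRule (FreeAlgebra.ι ℝ x * FreeAlgebra.ι ℝ y)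
      (bisign x.bideg y.bideg • (FreeAlgebra.ι ℝ y * FreeAlgebra.ι ℝ x))

/-- The bigraded-commutative algebra `ℝ[(ψ^α)_α, (e^a)_a]` underlying the Chevalley–Eilenberg
algebra of the type IIA super-Minkowski algebra. -/
def CE : Type := RingQuot SignRule

namespace CE

instance : Semiring CE := inferInstanceAs (Semiring (RingQuot SignRule))

instance : Algebra ℝ CE := inferInstanceAs (Algebra ℝ (RingQuot SignRule))

instance : Ring CE := Algebra.semiringToRing ℝ

/-- The quotient map. -/
def mk : FreeAlgebra ℝ Gen →ₐ[ℝ] CE := RingQuot.mkAlgHom ℝ SignRule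

theorem mk_surjective : Function.Surjective mk := RingQuot.mkAlgHom_surjective ℝ SignRule

theorem mk_rel {a b : FreeAlgebra ℝ Gen} (h : SignRule a b) : mk a = mk b :=
  RingQuot.mkAlgHom_rel ℝ h

/-- The generators as elements of the algebra. -/
def gen (x : Gen) : CE := mk (FreeAlgebra.ι ℝ x)

/-- The generator `ψ^α`. -/
def psi (α : Fin 32) : CE := gen (.psi α)

/-- The generator `e^a`. -/
def e (a : Fin 10) : CE := gen (.e a)

theorem gen_swap (x y : Gen) : gen x * gen y = bisign x.bideg y.bideg • (gen y * gen x) := by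
  have h := mk_rel (SignRule.swap x y)
  rwa [map_mul, map_smul, map_mul] at h

theorem psi_psi (α β : Fin 32) : psi α * psi β = psi β * psi α := by
  have h := gen_swap (.psi α) (.psi β)
  have hs : bisign (Gen.psi α).bideg (Gen.psi β).bideg = 1 := by
    simp [bisign, Gen.bideg, ZMod.val_one]
  rwa [hs, one_smul] at h

theorem e_psi (a : Fin 10) (α : Fin 32) : e a * psi α = -(psi α * e a) := by
  have h := gen_swap (.e a) (.psi α)
  have hs : bisign (Gen.e a).bideg (Gen.psi α).bideg = -1 := by
    simp [bisign, Gen.bideg]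
  rwa [hs, neg_one_smul] at h

theorem e_e (a b : Fin 10) : e a * e b = -(e b * e a) := by
  have h := gen_swap (.e a) (.e b)
  have hs : bisign (Gen.e a).bideg (Gen.e b).bideg = -1 := by
    simp [bisign, Gen.bideg]
  rwa [hs, neg_one_smul] at h

/-- Algebra maps out of `CE` are determined by images of generators that obey the sign rule. -/
def lift {A : Type} [Ring A] [Algebra ℝ A] (f : Gen → A)
    (hf : ∀ x y, f x * f y = bisign x.bideg y.bideg • (f y * f x)) : CE →ₐ[ℝ] A :=
  RingQuot.liftAlgHom ℝ ⟨FreeAlgebra.lift ℝ f, by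
    rintro _ _ ⟨x, y⟩
    simpa using hf x y⟩

theorem lift_gen {A : Type} [Ring A] [Algebra ℝ A] (f : Gen → A)
    (hf : ∀ x y, f x * f y = bisign x.bideg y.bideg • (f y * f x)) (x : Gen) :
    lift f hf (gen x) = f x := by
  have h := RingQuot.liftAlgHom_mkAlgHom_apply ℝ (FreeAlgebra.lift ℝ f) (s := SignRule) (by
    rintro _ _ ⟨x, y⟩
    simpa using hf x y) (FreeAlgebra.ι ℝ x)
  rw [FreeAlgebra.lift_ι_apply] at h
  exact h

theorem induction {P : CE → Prop} (halg : ∀ r : ℝ, P (algebraMap ℝ CE r))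
    (hgen : ∀ x, P (gen x)) (hadd : ∀ x y, P x → P y → P (x + y))
    (hmul : ∀ x y, P x → P y → P (x * y)) (x : CE) : P x := by
  obtain ⟨y, rfl⟩ := mk_surjective x
  induction y using FreeAlgebra.induction with
  | grade0 r => rw [AlgHom.commutes]; exact halg r
  | grade1 x => exact hgen x
  | mul a b ha hb => rw [map_mul]; exact hmul _ _ ha hb
  | add a b ha hb => rw [map_add]; exact hadd _ _ ha hb

/-- The parity involution `x ↦ (-1)^n x` for `n` the homological degree of `x`
(all generators have homological degree 1). -/
def parity : CE →ₐ[ℝ] CE :=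
  lift (fun x => -gen x) (fun x y => by simpa using gen_swap x y)

theorem parity_gen (x : Gen) : parity (gen x) = -gen x := lift_gen _ _ x

end CE

namespace MajoranaRep

variable (M : MajoranaRep)

open CE

/-- For a matrix `A` acting on spinors, the element
`(ψ̄ A ψ) = η_{αα'} A^{α'}_β ψ^α ψ^β` of the Chevalley–Eilenberg algebra. -/
def bilinear (A : Matrix (Fin 32) (Fin 32) ℝ) : CE :=
  ∑ α, ∑ β, (M.pairing * A) α β • (psi α * psi β)

theorem psi_bilinear (α : Fin 32) (A : Matrix (Fin 32) (Fin 32) ℝ) :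
    psi α * M.bilinear A = M.bilinear A * psi α := by
  simp only [bilinear, Finset.mul_sum, Finset.sum_mul, mul_smul_comm, smul_mul_assoc]
  refine Finset.sum_congr rfl fun β _ => Finset.sum_congr rfl fun γ _ => ?_
  rw [← mul_assoc, psi_psi α β, mul_assoc, psi_psi α γ, mul_assoc]

theorem e_bilinear (a : Fin 10) (A : Matrix (Fin 32) (Fin 32) ℝ) :
    e a * M.bilinear A = M.bilinear A * e a := by
  simp only [bilinear, Finset.mul_sum, Finset.sum_mul, mul_smul_comm, smul_mul_assoc]
  refine Finset.sum_congr rfl fun β _ => Finset.sum_congr rfl fun γ _ => ?_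
  rw [← mul_assoc, e_psi, neg_mul, mul_assoc, e_psi, mul_neg, neg_neg, mul_assoc]

/-! ## The differential -/

/-- The differential on generators: `d ψ^α = 0` and `d e^a = (ψ̄ Γ^a ψ)`. -/
def dGen : Gen → CE
  | .psi _ => 0
  | .e a => M.bilinear (M.gammaUp a.castSucc)

theorem gen_dGen (x y : Gen) : gen x * M.dGen y = M.dGen y * gen x := by
  cases y with
  | psi β => simp [dGen]
  | e b => cases x with
    | psi α => exact M.psi_bilinear α _
    | e a => exact M.e_bilinear a _

theorem dGen_swap (x y : Gen) : M.dGen x * gen y - gen x * M.dGen y =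
    bisign x.bideg y.bideg • (M.dGen y * gen x - gen y * M.dGen x) := by
  cases x with
  | psi α => cases y with
    | psi β => simp [dGen]
    | e b =>
      have hs : bisign (Gen.psi α).bideg (Gen.e b).bideg = -1 := by simp [bisign, Gen.bideg]
      have h := M.gen_dGen (.psi α) (.e b)
      have h0 : M.dGen (.psi α) = 0 := rfl
      rw [hs, h, h0]; simp
  | e a => cases y with
    | psi β =>
      have hs : bisign (Gen.e a).bideg (Gen.psi β).bideg = -1 := by simp [bisign, Gen.bideg]
      have h := M.gen_dGen (.psi β) (.e a)
      have h0 : M.dGen (.psi β) = 0 := rfl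
      rw [hs, h, h0]; simp
    | e b =>
      have hs : bisign (Gen.e a).bideg (Gen.e b).bideg = -1 := by simp [bisign, Gen.bideg]
      rw [hs, M.gen_dGen (.e a) (.e b), M.gen_dGen (.e b) (.e a)]; simp

/-- A graded derivation `d` is the same as the upper right entry of an algebra map
`x ↦ [[(-1)^n x, d x], [0, x]]`. -/
def dMat : CE →ₐ[ℝ] Matrix (Fin 2) (Fin 2) CE :=
  CE.lift (fun x => !![-gen x, M.dGen x; 0, gen x]) (fun x y => by
    have h1 := gen_swap x y
    have h2 := M.dGen_swap x y
    ext i j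
    fin_cases i <;> fin_cases j
    · simpa [Matrix.mul_apply] using h1
    · simpa [Matrix.mul_apply, sub_eq_neg_add] using h2
    · simp [Matrix.mul_apply]
    · simpa [Matrix.mul_apply] using h1)

/-- The differential `d` of the Chevalley–Eilenberg algebra
`CE(ℝ^{1,9|𝟏𝟔 ⊕ 𝟏𝟔bar})`: the graded derivation with `d ψ^α = 0` and `d e^a = (ψ̄ Γ^a ψ)`. -/
def d : CE →ₗ[ℝ] CE where
  toFun x := M.dMat x 0 1
  map_add' x y := by simp
  map_smul' r x := by simp

theorem dMat_gen (x : Gen) : M.dMat (gen x) = !![-gen x, M.dGen x; 0, gen x] :=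
  CE.lift_gen _ _ x

theorem dMat_eq (x : CE) : M.dMat x = !![parity x, M.d x; 0, x] := by
  have key : M.dMat x 0 0 = parity x ∧ M.dMat x 1 0 = 0 ∧ M.dMat x 1 1 = x := by
    induction x using CE.induction with
    | halg r => simp [Matrix.algebraMap_matrix_apply]
    | hgen x => simp [dMat_gen, parity_gen]
    | hadd x y hx hy => simp [hx, hy]
    | hmul x y hx hy => simp [Matrix.mul_apply, hx, hy]
  ext i j
  fin_cases i <;> fin_cases j
  · simpa using key.1
  · rfl
  · simpa using key.2.1
  · simpa using key.2.2

theorem d_psi (α : Fin 32) : M.d (psi α) = 0 := by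
  simp [d, psi, dMat_gen, dGen]

theorem d_e (a : Fin 10) : M.d (e a) = M.bilinear (M.gammaUp a.castSucc) := by
  simp [d, e, dMat_gen, dGen]

/-- The graded Leibniz rule. -/
theorem d_mul (x y : CE) : M.d (x * y) = M.d x * y + parity x * M.d y := by
  have h : M.d (x * y) = (M.dMat x * M.dMat y) 0 1 := by
    rw [← map_mul]; rfl
  rw [h, dMat_eq, dMat_eq]
  simp [Matrix.mul_apply, add_comm]

theorem d_algebraMap (r : ℝ) : M.d (algebraMap ℝ CE r) = 0 := by
  have h : M.d (algebraMap ℝ CE r) = (algebraMap ℝ (Matrix (Fin 2) (Fin 2) CE) r) 0 1 := by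
    rw [← M.dMat.commutes]; rfl
  rw [h]; simp [Matrix.algebraMap_matrix_apply]

theorem parity_bilinear (A : Matrix (Fin 32) (Fin 32) ℝ) :
    parity (M.bilinear A) = M.bilinear A := by
  simp [bilinear, psi, parity_gen]

theorem d_bilinear (A : Matrix (Fin 32) (Fin 32) ℝ) : M.d (M.bilinear A) = 0 := by
  simp [bilinear, d_mul, d_psi]

theorem parity_parity (x : CE) : parity (parity x) = x := by
  induction x using CE.induction with
  | halg r => simp
  | hgen x => simp [parity_gen]
  | hadd x y hx hy => simp [hx, hy]
  | hmul x y hx hy => simp [hx, hy]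

theorem d_parity (x : CE) : M.d (parity x) = -parity (M.d x) := by
  induction x using CE.induction with
  | halg r => simp [d_algebraMap]
  | hgen x =>
    cases x with
    | psi α =>
      have h := M.d_psi α
      unfold psi at h
      simp [parity_gen, h]
    | e a =>
      have h := M.d_e a
      unfold e at h
      simp [parity_gen, h, parity_bilinear]
  | hadd x y hx hy => simp [hx, hy, add_comm]
  | hmul x y hx hy =>
    rw [map_mul, d_mul, d_mul, hx, hy, parity_parity, map_add, map_mul, map_mul, parity_parity]
    noncomm_ring

/-- The differential squares to zero. -/
theorem d_d (x : CE) : M.d (M.d x) = 0 := by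
  induction x using CE.induction with
  | halg r => simp [d_algebraMap]
  | hgen x =>
    cases x with
    | psi α => simp [← psi.eq_def, d_psi]
    | e a => simp [← e.eq_def, d_e, d_bilinear]
  | hadd x y hx hy => simp [hx, hy]
  | hmul x y hx hy => simp [d_mul, hx, hy, parity_parity, d_parity]

/-! ## The super-flux densities -/

/-- `(1/p!) (ψ̄ Γ_{a_1 ⋯ a_p} A ψ) e^{a_1} ⋯ e^{a_p}`, summed over `a_i = 0, …, 9`. -/
def flux (p : ℕ) (A : Matrix (Fin 32) (Fin 32) ℝ) : CE :=
  ((p.factorial : ℝ)⁻¹) • ∑ a : Fin p → Fin 10,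
    M.bilinear (M.gammaSkew (fun i => (a i).castSucc) * A) * (List.ofFn fun i => e (a i)).prod

/-- `H_3^A = (ψ̄ Γ_a Γ_10 ψ) e^a`. -/
def H3A : CE := ∑ a : Fin 10, M.bilinear (M.gamma a.castSucc * M.gamma 10) * e a

/-- `F_6 = (1/4!) (ψ̄ Γ_{a_1 ⋯ a_4} Γ_10 ψ) e^{a_1} ⋯ e^{a_4}`. -/
def F6 : CE := M.flux 4 (M.gamma 10)

/-- `F_8 = (1/6!) (ψ̄ Γ_{a_1 ⋯ a_6} ψ) e^{a_1} ⋯ e^{a_6}`. -/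
def F8 : CE := M.flux 6 1

/-- `F_10 = (1/8!) (ψ̄ Γ_{a_1 ⋯ a_8} Γ_10 ψ) e^{a_1} ⋯ e^{a_8}`. -/
def F10 : CE := M.flux 8 (M.gamma 10)

/-- `F_12 = (1/10!) (ψ̄ Γ_{a_1 ⋯ a_10} ψ) e^{a_1} ⋯ e^{a_10}`. -/
def F12 : CE := M.flux 10 1

end MajoranaRep

/-! ## Existence of the Majorana representation -/

namespace Model

/-- The sign `(-1)^(number of bits of x)`. -/
def bitSign (x : Fin 32) : ℤ :=
  ∏ i : Fin 5, if x.val.testBit i.val then -1 else 1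

theorem bitSign_xor : ∀ x y : Fin 32, bitSign (x ^^^ y) = bitSign x * bitSign y := by
  decide +kernel

theorem and_xor : ∀ z x y : Fin 32, z &&& (x ^^^ y) = (z &&& x) ^^^ (z &&& y) := by
  decide +kernel

theorem xor_and : ∀ z x y : Fin 32, (x ^^^ y) &&& z = (x &&& z) ^^^ (y &&& z) := by
  decide +kernel

theorem eq_xor : ∀ i j m : Fin 32, i = j ^^^ m ↔ j = i ^^^ m := by
  decide +kernel

theorem xor_assoc' : ∀ i j m : Fin 32, (i ^^^ j) ^^^ m = i ^^^ (j ^^^ m) := by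
  decide +kernel

theorem xor_comm' : ∀ i j : Fin 32, i ^^^ j = j ^^^ i := by
  decide +kernel

/-- The real Pauli-type matrix `X^m Z^z` on five real two-component systems. -/
def pauli (m z : Fin 32) : Matrix (Fin 32) (Fin 32) ℝ :=
  Matrix.of fun i j => if i = j ^^^ m then (bitSign (z &&& j) : ℝ) else 0

theorem pauli_mul (m z m' z' : Fin 32) :
    pauli m z * pauli m' z' =
      (bitSign (z &&& m') : ℝ) • pauli (m ^^^ m') (z ^^^ z') := by
  ext i j
  have h1 : (j ^^^ m') ^^^ m = j ^^^ (m ^^^ m') := by rw [xor_assoc', xor_comm' m']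
  simp only [pauli, Matrix.mul_apply, Matrix.of_apply, Matrix.smul_apply, smul_eq_mul, mul_ite,
    mul_zero, Finset.sum_ite_eq', Finset.mem_univ, if_true, h1]
  split_ifs
  · rw [and_xor, xor_and, bitSign_xor, bitSign_xor]; push_cast; ring
  · simp

theorem pauli_zero : pauli 0 0 = 1 := by
  ext i j
  have h1 : ∀ j : Fin 32, j ^^^ 0 = j ∧ bitSign (0 &&& j) = 1 := by decide +kernel
  simp [pauli, Matrix.one_apply, h1]

theorem pauli_transpose (m z : Fin 32) :
    (pauli m z).transpose = (bitSign (z &&& m) : ℝ) • pauli m z := by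
  ext i j
  simp only [pauli, Matrix.transpose_apply, Matrix.of_apply, Matrix.smul_apply, smul_eq_mul,
    mul_ite, mul_zero]
  by_cases h : i = j ^^^ m
  · rw [if_pos h, if_pos ((eq_xor i j m).1 h), h, and_xor, bitSign_xor]; push_cast; ring
  · rw [if_neg h, if_neg (fun h' => h ((eq_xor i j m).2 h'))]

/-- Signs and exponents of the Clifford generators. -/
def sgn : Fin 11 → ℤ := ![1, 1, 1, 1, 1, 1, 1, 1, 1, 1, -1]

/-- Exponents of `X`. -/
def xs : Fin 11 → Fin 32 := ![1, 0, 1, 3, 7, 11, 15, 19, 23, 27, 31]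

/-- Exponents of `Z`. -/
def zs : Fin 11 → Fin 32 := ![1, 1, 2, 0, 6, 14, 26, 30, 18, 22, 10]

/-- Explicit real Clifford generators. -/
def gamma (a : Fin 11) : Matrix (Fin 32) (Fin 32) ℝ := (sgn a : ℝ) • pauli (xs a) (zs a)

end Model

open Model in
/-- An explicit real 32-dimensional representation, with spinor metric `Γ_0`. -/
def majoranaModel : MajoranaRep where
  gamma := Model.gamma
  pairing := pauli 1 1
  clifford a b := by
    have h : ∀ a b : Fin 11, sgn a * sgn b * bitSign (zs a &&& xs b) +
        sgn b * sgn a * bitSign (zs b &&& xs a) =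
        2 * (if a = b then (if a = 0 then -1 else 1) else 0) := by decide +kernel
    have h0 : ∀ x : Fin 32, x ^^^ x = 0 := by decide +kernel
    have hab := congrArg (Int.cast : ℤ → ℝ) (h a b)
    push_cast at hab
    simp only [Model.gamma, smul_mul_smul_comm, pauli_mul, smul_smul]
    rw [xor_comm' (xs b), xor_comm' (zs b), ← add_smul, hab, minkowski]
    by_cases hh : a = b
    · subst hh
      rw [h0, h0, pauli_zero]
    · simp [hh]
  volume_eq := by
    have hp : ∀ (s : ℝ) (m z : Fin 32), s = 1 → m = 0 → z = 0 → s • pauli m z = 1 := by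
      rintro s m z rfl rfl rfl
      rw [one_smul, pauli_zero]
    simp only [List.ofFn_succ, List.ofFn_zero, List.prod_cons, List.prod_nil, mul_one,
      Model.gamma, smul_mul_smul_comm, pauli_mul, smul_smul]
    refine hp _ _ _ ?_ (by decide +kernel) (by decide +kernel)
    norm_cast
  pairing_skew := by
    have h : bitSign (1 &&& 1) = -1 := by decide +kernel
    rw [pauli_transpose, h]; simp
  pairing_nondegenerate := by
    have h : bitSign (1 &&& 1) = -1 := by decide +kernel
    have h0 : (1 : Fin 32) ^^^ 1 = 0 := by decide +kernel
    have h1 : pauli 1 1 * -pauli 1 1 = 1 := by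
      rw [mul_neg, pauli_mul, h, h0, pauli_zero]; simp
    exact IsUnit.of_mul_eq_one _ h1
  gamma_skew_adjoint a := by
    have h : ∀ a : Fin 11, sgn a * (bitSign (zs a &&& xs a) * bitSign (zs a &&& 1)) =
        -(sgn a * bitSign (1 &&& xs a)) := by decide +kernel
    have ha := congrArg (Int.cast : ℤ → ℝ) (h a)
    push_cast at ha
    simp only [Model.gamma, Matrix.transpose_smul, pauli_transpose, smul_mul_assoc,
      mul_smul_comm, pauli_mul, smul_smul]
    rw [xor_comm' 1, xor_comm' 1, mul_assoc, ha, neg_smul]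

instance : Nonempty MajoranaRep := ⟨majoranaModel⟩

end SuperIIA

end

/-!
In terms of the matrix-valued forms `E = Γ_a e^a`, `V = dE = Γ_a (ψ̄ Γ^a ψ)` and
`H = Γ_a (ψ̄ Γ^a Γ_10 ψ)`, the flux densities are `F_{2k} = (ψ̄ E^{2k-2} A ψ) / (2k-2)!` with `A`
one of `1` and `Γ_10`: the entries `e^a` of `E` anticommute, so the product skew-symmetrizes the
gamma matrices by itself. Clifford algebra gives `d(E^{2k+2}) = (k+1) [V, E^{2k+1}]` and
`H E^{2k+1} + E^{2k+1} H = (4k+2) H_3^A E^{2k}`. Since `Γ_10` anticommutes with `V`, `H` and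
`E^{2k+1}`, the cubic Fierz identity `(V Γ_10 + H) ψ = 0` trades the commutator with `V` for the
anticommutator with `H`, so `dF_{2k+2} = H_3^A F_{2k}`; at the top, `E^{11} = 0` gives
`H_3^A F_{12} = 0`.

The Fierz identity comes from expanding the matrix `ψ ψ̄` in the basis `Γ_J`, `|J| ≤ 5`, whose
coefficients vanish for `|J| = 3, 4`. The operator `X ↦ Γ_a [Γ_10, X] Γ^a` scales each `Γ_J` (up to
a factor `Γ_10`) and kills every remaining term except those for `J = {b}` and `J = {b, 10}`, which
reproduce `W = V Γ_10 + H`. Applied to `ψ`, it sends `ψ ψ̄` to `W ψ` on the one hand and to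
`-W ψ / 2` on the other.
-/

noncomputable section

namespace SuperIIA

open Matrix Finset

/-! ## Clifford algebras and Fierz expansion -/

theorem exists_odd_card_erase_add_card_erase {ι : Type*} [Fintype ι] [DecidableEq ι]
    {I J : Finset ι} (hne : I ≠ J) (hcard : #I + #J < Fintype.card ι) :
    ∃ a, Odd (#(I.erase a) + #(J.erase a)) := by
  rcases Nat.even_or_odd (#I + #J) with heven | hodd
  · obtain ⟨a, ha⟩ : ∃ a, ¬(a ∈ I ↔ a ∈ J) := by
      by_contra! hall
      exact hne (Finset.ext hall)
    refine ⟨a, ?_⟩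
    have hI := I.card_erase_add_one (a := a)
    have hJ := J.card_erase_add_one (a := a)
    have hI' := I.erase_eq_of_notMem (a := a)
    have hJ' := J.erase_eq_of_notMem (a := a)
    by_cases haI : a ∈ I <;> by_cases haJ : a ∈ J <;> grind
  · obtain ⟨a, ha⟩ : ∃ a, a ∉ I ∪ J := by
      by_contra! hall
      rw [← eq_univ_iff_forall] at hall
      exact hcard.not_ge (card_univ (α := ι) ▸ hall ▸ card_union_le I J)
    rw [mem_union, not_or] at ha
    exact ⟨a, by rwa [erase_eq_of_notMem ha.1, erase_eq_of_notMem ha.2]⟩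

section CliffordProd

variable {ι A : Type*} [LinearOrder ι] [Monoid A]

/-- The basis element `γ_J` of a Clifford algebra: the product of the generators with index in `J`,
taken in increasing order. -/
def cliffordProd (γ : ι → A) (J : Finset ι) : A := ((J.sort (· ≤ ·)).map γ).prod

theorem cliffordProd_empty (γ : ι → A) : cliffordProd γ ∅ = 1 := by simp [cliffordProd]

theorem cliffordProd_insert (γ : ι → A) {b : ι} {J : Finset ι} (hb : ∀ c ∈ J, b < c) :
    cliffordProd γ (insert b J) = γ b * cliffordProd γ J := by
  rw [cliffordProd, sort_insert (· ≤ ·) (fun c hc => (hb c hc).le) fun h => (hb b h).false,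
    List.map_cons, List.prod_cons, cliffordProd]

theorem cliffordProd_singleton (γ : ι → A) (b : ι) : cliffordProd γ {b} = γ b := by
  simp [cliffordProd]

end CliffordProd

section CliffordFamily

variable {ι K A : Type*} [CommRing K] [Ring A] [Algebra K A]

/-- The Clifford relations `γ a γ b + γ b γ a = 2 q a δ_{ab}`, divided by `2`: the images of an
orthogonal basis in a representation of the Clifford algebra of the quadratic form `q`. -/
structure IsCliffordFamily (q : ι → K) (γ : ι → A) : Prop where
  mul_self : ∀ a, γ a * γ a = q a • 1
  anticomm : ∀ ⦃a b⦄, a ≠ b → γ a * γ b = -(γ b * γ a)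

variable [LinearOrder ι]

namespace IsCliffordFamily

variable {q : ι → K} {γ : ι → A}

theorem mul_cliffordProd (h : IsCliffordFamily q γ) (a : ι) (J : Finset ι) :
    γ a * cliffordProd γ J = (-1 : K) ^ #(J.erase a) • (cliffordProd γ J * γ a) := by
  induction J using Finset.induction_on_min with
  | empty => simp [cliffordProd_empty]
  | insert b J hb ih =>
    have hbJ : b ∉ J := fun hJ => (hb b hJ).false
    rw [cliffordProd_insert γ hb]
    by_cases hab : a = b
    · subst hab
      rw [erase_eq_of_notMem hbJ] at ih
      rw [erase_insert hbJ]
      nth_rewrite 1 [ih]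
      rw [mul_smul_comm, mul_assoc]
    · have hbJ' : b ∉ J.erase a := fun hJ => hbJ (mem_of_mem_erase hJ)
      rw [erase_insert_of_ne (Ne.symm hab), card_insert_of_notMem hbJ', ← mul_assoc,
        h.anticomm hab, neg_mul, mul_assoc, ih, mul_smul_comm, pow_succ, mul_neg_one, neg_smul,
        mul_assoc]

theorem cliffordProd_mul_self (h : IsCliffordFamily q γ) (J : Finset ι) :
    cliffordProd γ J * cliffordProd γ J = ((-1) ^ (#J).choose 2 * ∏ a ∈ J, q a) • 1 := by
  induction J using Finset.induction_on_min with
  | empty => simp [cliffordProd_empty]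
  | insert b J hb ih =>
    have hbJ : b ∉ J := fun hJ => (hb b hJ).false
    have hcomm := h.mul_cliffordProd b J
    rw [erase_eq_of_notMem hbJ] at hcomm
    rw [cliffordProd_insert γ hb, card_insert_of_notMem hbJ, prod_insert hbJ]
    nth_rewrite 1 [hcomm]
    rw [smul_mul_assoc, mul_assoc, ← mul_assoc (γ b), h.mul_self, smul_mul_assoc, one_mul,
      mul_smul_comm, ih, smul_smul, smul_smul, Nat.choose_succ_succ' _ 1, Nat.choose_one_right,
      pow_add]
    ring_nf

end IsCliffordFamily

section Matrix

variable {n : Type*} [Fintype n] [DecidableEq n]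

theorem IsCliffordFamily.transpose_cliffordProd_mul {q : ι → K} {γ : ι → Matrix n n K}
    (h : IsCliffordFamily q γ) {P : Matrix n n K} (hP : ∀ a, (γ a)ᵀ * P = -(P * γ a))
    (J : Finset ι) :
    (cliffordProd γ J)ᵀ * P = (-1 : K) ^ (#J + 1).choose 2 • (P * cliffordProd γ J) := by
  induction J using Finset.induction_on_min with
  | empty => simp [cliffordProd_empty]
  | insert b J hb ih =>
    have hbJ : b ∉ J := fun hJ => (hb b hJ).false
    have hcomm := h.mul_cliffordProd b J
    rw [erase_eq_of_notMem hbJ] at hcomm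
    have hchoose : (#J + 1 + 1).choose 2 = #J + 1 + (#J + 1).choose 2 := by
      rw [Nat.choose_succ_succ' _ 1, Nat.choose_one_right]
    have hsq : (-1 : K) ^ #J * (-1) ^ #J = 1 := by rw [← mul_pow, neg_mul_neg, one_mul, one_pow]
    rw [cliffordProd_insert γ hb, card_insert_of_notMem hbJ, transpose_mul, mul_assoc, hP, mul_neg,
      ← mul_assoc, ih, hcomm, hchoose, smul_mul_assoc, mul_smul_comm, smul_smul, ← neg_smul,
      mul_assoc]
    congr 1
    linear_combination (-1 : K) ^ (#J + 1).choose 2 * hsq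

namespace IsCliffordFamily

variable {K : Type*} [Field K] {q : ι → K} {γ : ι → Matrix n n K}

theorem cliffordProd_mul_inv_smul (h : IsCliffordFamily q γ) (hq : ∀ a, q a ≠ 0) (J : Finset ι) :
    cliffordProd γ J * (((-1) ^ (#J).choose 2 * ∏ a ∈ J, q a)⁻¹ • cliffordProd γ J) = 1 := by
  rw [mul_smul_comm, h.cliffordProd_mul_self, inv_smul_smul₀]
  exact mul_ne_zero (pow_ne_zero _ (neg_ne_zero.2 one_ne_zero)) (prod_ne_zero_iff.2 fun a _ => hq a)

theorem isUnit_cliffordProd (h : IsCliffordFamily q γ) (hq : ∀ a, q a ≠ 0) (J : Finset ι) :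
    IsUnit (cliffordProd γ J) :=
  .of_mul_eq_one _ (h.cliffordProd_mul_inv_smul hq J)

theorem inv_cliffordProd (h : IsCliffordFamily q γ) (hq : ∀ a, q a ≠ 0) (J : Finset ι) :
    (cliffordProd γ J)⁻¹ =
      ((-1) ^ (#J).choose 2 * ∏ a ∈ J, q a)⁻¹ • cliffordProd γ J :=
  inv_eq_right_inv (h.cliffordProd_mul_inv_smul hq J)

end IsCliffordFamily

end Matrix

end CliffordFamily

section Fierz

variable {ι K n : Type*} [Fintype ι] [LinearOrder ι] [Field K] [NeZero (2 : K)]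
  [Fintype n] [DecidableEq n]

theorem trace_eq_zero_of_anticomm {g X : Matrix n n K} (hg : IsUnit g)
    (hgX : g * X = -(X * g)) : X.trace = 0 := by
  obtain ⟨u, rfl⟩ := hg
  have hneg : X.trace = -X.trace := by
    rw [← trace_neg, ← Units.mul_inv_cancel_right (-X) u, neg_mul, ← hgX, trace_units_conj]
  have h2 : (2 : K) * X.trace = 0 := by linear_combination hneg
  exact (mul_eq_zero.1 h2).resolve_left (NeZero.ne 2)

namespace IsCliffordFamily

variable {q : ι → K} {γ : ι → Matrix n n K}

/- Since `γ_a` commutes with `γ_I γ_J⁻¹` up to `(-1) ^ (|I \ a| + |J \ a|)`, it suffices to find an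
index `a` for which this sign is `-1`. -/
theorem trace_cliffordProd_mul_inv (h : IsCliffordFamily q γ) (hq : ∀ a, q a ≠ 0)
    {I J : Finset ι} (hcard : #I + #J < Fintype.card ι) :
    (cliffordProd γ I * (cliffordProd γ J)⁻¹).trace =
      if I = J then (Fintype.card n : K) else 0 := by
  split_ifs with hIJ
  · have hdet := (isUnit_iff_isUnit_det _).1 (h.isUnit_cliffordProd hq J)
    rw [hIJ, mul_nonsing_inv _ hdet, trace_one]
  · obtain ⟨a, ha⟩ := exists_odd_card_erase_add_card_erase hIJ hcard
    rw [h.inv_cliffordProd hq, mul_smul_comm, trace_smul, smul_eq_mul]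
    refine mul_eq_zero_of_right _ (trace_eq_zero_of_anticomm (g := γ a) ?_ ?_)
    · rw [← cliffordProd_singleton γ a]
      exact h.isUnit_cliffordProd hq {a}
    · rw [← mul_assoc, h.mul_cliffordProd, smul_mul_assoc, mul_assoc, h.mul_cliffordProd,
        mul_smul_comm, smul_smul, ← pow_add, ha.neg_one_pow, neg_one_smul, mul_assoc]

end IsCliffordFamily

end Fierz

theorem card_finset_card_le_half {ι : Type*} [Fintype ι] {m : ℕ}
    (hι : Fintype.card ι = 2 * m + 1) :
    Fintype.card {J : Finset ι // #J ≤ m} = 4 ^ m := by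
  classical
  have hmaps : ∀ J ∈ ({J | #J ≤ m} : Finset (Finset ι)), #J ∈ range (m + 1) := fun J hJ =>
    mem_range_succ_iff.2 (mem_filter_univ J |>.1 hJ)
  rw [Fintype.card_subtype, ← Nat.sum_range_choose_halfway m, card_eq_sum_card_fiberwise hmaps]
  refine sum_congr rfl fun k hk => ?_
  rw [← hι, ← card_univ, ← card_powersetCard]
  congr 1
  ext J
  simp only [mem_filter, mem_univ, true_and, mem_powersetCard, subset_univ]
  rw [mem_range] at hk
  omega

theorem IsCliffordFamily.fierz {ι K n : Type*} [Fintype ι] [LinearOrder ι] [Field K]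
    [NeZero (2 : K)] [Fintype n] [DecidableEq n] {q : ι → K} {γ : ι → Matrix n n K}
    (h : IsCliffordFamily q γ) (hq : ∀ a, q a ≠ 0) {m : ℕ}
    (hι : Fintype.card ι = 2 * m + 1) (hn : Fintype.card n = 2 ^ m) (X : Matrix n n K) :
    (2 ^ m : K) • X = ∑ J : {J : Finset ι // #J ≤ m},
      (X * (cliffordProd γ J.1)⁻¹).trace • cliffordProd γ J.1 := by
  have htrace (c : {J : Finset ι // #J ≤ m} → K) (I : {J : Finset ι // #J ≤ m}) :
      ((∑ J, c J • cliffordProd γ J.1) * (cliffordProd γ I.1)⁻¹).trace = 2 ^ m * c I := by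
    have hterm (J : {J : Finset ι // #J ≤ m}) :
        (c J • cliffordProd γ J.1 * (cliffordProd γ I.1)⁻¹).trace =
          if J = I then 2 ^ m * c J else 0 := by
      have hcard : #J.1 + #I.1 < Fintype.card ι := by
        have := J.2
        have := I.2
        omega
      rw [smul_mul_assoc, trace_smul, h.trace_cliffordProd_mul_inv hq hcard, hn]
      simp [Subtype.ext_iff, mul_comm]
    rw [sum_mul, trace_sum, sum_congr rfl fun J _ => hterm J, sum_ite_eq' _ _ _,
      if_pos (mem_univ _)]
  have h2 : (2 ^ m : K) ≠ 0 := pow_ne_zero _ (NeZero.ne 2)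
  have hind : LinearIndependent K fun J : {J : Finset ι // #J ≤ m} => cliffordProd γ J.1 := by
    rw [Fintype.linearIndependent_iff]
    intro c hc I
    have hcI := htrace c I
    rw [hc, zero_mul, trace_zero] at hcI
    exact (mul_eq_zero.1 hcI.symm).resolve_left h2
  have hspan := hind.span_eq_top_of_card_eq_finrank' (by
    rw [card_finset_card_le_half hι, Module.finrank_matrix, hn, Module.finrank_self, mul_one,
      ← mul_pow]
    norm_num)
  obtain ⟨c, rfl⟩ := (Submodule.mem_span_range_iff_exists_fun K).1
    (hspan ▸ Submodule.mem_top : X ∈ Submodule.span K _)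
  simp_rw [htrace, mul_smul]
  rw [smul_sum]

theorem sum_neg_one_pow_card_erase {ι R : Type*} [Fintype ι] [DecidableEq ι] [CommRing R]
    (J : Finset ι) :
    ∑ a, (-1 : R) ^ #(J.erase a) = (-1) ^ #J * (Fintype.card ι - 2 * #J) := by
  have hmem : ∀ a ∈ J, (-1 : R) ^ #(J.erase a) = -(-1) ^ #J := fun a ha => by
    rw [← card_erase_add_one ha, pow_succ]
    ring
  have hnot : ∀ a ∈ Jᶜ, (-1 : R) ^ #(J.erase a) = (-1) ^ #J := fun a ha => by
    rw [erase_eq_of_notMem (mem_compl.1 ha)]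
  rw [← sum_add_sum_compl J, sum_congr rfl hmem, sum_congr rfl hnot, sum_const, sum_const,
    nsmul_eq_mul, nsmul_eq_mul, card_compl, Nat.cast_sub (card_le_univ J)]
  ring

/-! ## Powers of an odd element -/

section OddElement

variable {R : Type*} [Ring R] {V E C : R}

theorem mul_odd_pow_add_odd_pow_mul (hV : V * E + E * V = 2 • C) (hC : E * C = -(C * E)) (k : ℕ) :
    V * E ^ (2 * k + 1) + E ^ (2 * k + 1) * V = (4 * k + 2) • (C * E ^ (2 * k)) := by
  have hVE : V * E = 2 • C - E * V := eq_sub_of_add_eq hV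
  have hVE2 : V * E ^ 2 = E ^ 2 * V + 4 • (C * E) := by
    rw [pow_two, ← mul_assoc, hVE, sub_mul, mul_assoc, hVE, mul_sub, mul_smul_comm, hC,
      smul_mul_assoc, mul_assoc]
    abel
  have hCE2 : E ^ 2 * C = C * E ^ 2 := by
    rw [pow_two, mul_assoc, hC, mul_neg, ← mul_assoc, hC, neg_mul, neg_neg, mul_assoc]
  induction k with
  | zero => simpa using hV
  | succ k ih =>
    calc V * E ^ (2 * (k + 1) + 1) + E ^ (2 * (k + 1) + 1) * V
        = V * E ^ 2 * E ^ (2 * k + 1) + E ^ 2 * (E ^ (2 * k + 1) * V) := by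
          rw [mul_assoc, ← mul_assoc (E ^ 2), ← pow_add]
          ring_nf
      _ = 4 • (C * (E * E ^ (2 * k + 1))) +
            E ^ 2 * (V * E ^ (2 * k + 1) + E ^ (2 * k + 1) * V) := by
          rw [hVE2, add_mul, mul_add, smul_mul_assoc, mul_assoc, mul_assoc]
          abel
      _ = (4 * (k + 1) + 2) • (C * E ^ (2 * (k + 1))) := by
          rw [ih, mul_smul_comm, ← mul_assoc (E ^ 2), hCE2, mul_assoc C (E ^ 2), ← pow_succ',
            ← pow_add, add_comm 2 (2 * k), ← add_smul]
          ring_nf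

theorem mul_even_pow (hV : V * E + E * V = 2 • C) (hC : E * C = -(C * E)) (k : ℕ) :
    V * E ^ (2 * k + 2) = E ^ (2 * k + 2) * V + (4 * (k + 1)) • (C * E ^ (2 * k + 1)) := by
  have hodd := eq_sub_of_add_eq (mul_odd_pow_add_odd_pow_mul hV hC k)
  have hEC : E ^ (2 * k + 1) * C = -(C * E ^ (2 * k + 1)) := by
    have hsemi : SemiconjBy C E (-E) := by rw [SemiconjBy, neg_mul, hC, neg_neg]
    have hpow := hsemi.pow_right (2 * k + 1)
    rw [SemiconjBy, Odd.neg_pow (odd_two_mul_add_one k), neg_mul] at hpow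
    rw [hpow, neg_neg]
  rw [pow_succ _ (2 * k + 1), ← mul_assoc, hodd, sub_mul, mul_assoc (E ^ _), eq_sub_of_add_eq hV,
    mul_sub, mul_smul_comm, hEC, smul_mul_assoc, mul_assoc, ← pow_succ, mul_assoc]
  module

theorem skewDerivation_even_pow (hV : V * E + E * V = 2 • C) (hC : E * C = -(C * E)) {D : R → R}
    {τ : R →+* R} (hD : ∀ x y, D (x * y) = D x * y + τ x * D y) (hτ : τ E = -E) (hDE : D E = V)
    (k : ℕ) :
    D (E ^ (2 * k + 2)) = (k + 1) • (V * E ^ (2 * k + 1) - E ^ (2 * k + 1) * V) := by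
  induction k with
  | zero => simp [pow_two, hD, hτ, hDE, sub_eq_add_neg]
  | succ k ih =>
    have hDE2 : D (E ^ 2) = V * E - E * V := by rw [pow_two, hD, hτ, hDE, neg_mul, sub_eq_add_neg]
    have hτE2 : τ (E ^ 2) = E ^ 2 := by rw [map_pow, hτ, neg_sq]
    have hleft : (V * E - E * V) * E ^ (2 * k + 2) = V * E ^ (2 * k + 3) - E ^ (2 * k + 3) * V +
        (4 * (k + 1)) • (C * E ^ (2 * k + 2)) := by
      rw [sub_mul, mul_assoc, ← pow_succ', mul_assoc E, mul_even_pow hV hC, mul_add, ← mul_assoc,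
        ← pow_succ', mul_smul_comm, ← mul_assoc E C, hC, neg_mul, mul_assoc C, ← pow_succ',
        smul_neg, sub_add_eq_sub_sub, sub_neg_eq_add]
    have hright : E ^ 2 * (V * E ^ (2 * k + 1) - E ^ (2 * k + 1) * V) =
        V * E ^ (2 * k + 3) - E ^ (2 * k + 3) * V - 4 • (C * E ^ (2 * k + 2)) := by
      have hE2V : E ^ 2 * V = V * E ^ 2 - 4 • (C * E) := by
        rw [eq_sub_iff_add_eq]
        simpa using (mul_even_pow hV hC 0).symm
      rw [mul_sub, ← mul_assoc, hE2V, sub_mul, mul_assoc, ← pow_add, ← mul_assoc, ← pow_add,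
        smul_mul_assoc, mul_assoc, ← pow_succ']
      ring_nf
      abel
    calc D (E ^ (2 * (k + 1) + 2))
        = D (E ^ 2) * E ^ (2 * k + 2) + E ^ 2 * D (E ^ (2 * k + 2)) := by
          rw [show 2 * (k + 1) + 2 = 2 + (2 * k + 2) by ring, pow_add, hD, hτE2]
      _ = (k + 1 + 1) • (V * E ^ (2 * (k + 1) + 1) - E ^ (2 * (k + 1) + 1) * V) := by
          rw [hDE2, hleft, ih, mul_smul_comm, hright, mul_add 2 k 1, add_assoc (2 * k)]
          module

end OddElement

section GradedExchange

variable {R : Type*} [Ring R] {V H X g : R}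

theorem commutator_mul_eq_anticommutator_sub (hX : g * X = -(X * g)) :
    (V * X - X * V) * g = H * X + X * H - ((V * g + H) * X + X * (V * g + H)) := by
  have hVX : V * g * X = -(V * X * g) := by rw [mul_assoc, hX, mul_neg, mul_assoc]
  rw [add_mul, hVX]
  noncomm_ring

theorem commutator_eq_anticommutator_mul_add (hg : g * g = 1) (hV : g * V = -(V * g))
    (hH : g * H = -(H * g)) (hX : g * X = -(X * g)) :
    V * X - X * V =
      (H * X + X * H) * g + ((V * g + H) * (g * X) + X * g * (V * g + H)) := by
  have hVgX : V * g * (g * X) = V * X := by rw [mul_assoc, ← mul_assoc g, hg, one_mul]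
  have hXgV : X * g * (V * g) = -(X * V) := by
    rw [mul_assoc, ← mul_assoc g, hV, neg_mul, mul_assoc, hg, mul_one, mul_neg]
  have hXgH : X * g * H = -(X * H * g) := by rw [mul_assoc, hH, mul_neg, mul_assoc]
  rw [add_mul (V * g), mul_add (X * g), hVgX, hXgV, hXgH, hX]
  noncomm_ring

end GradedExchange

theorem sum_pow_eq_sum_prod_ofFn {R κ : Type*} [Semiring R] [Fintype κ] (x : κ → R) (p : ℕ) :
    (∑ k, x k) ^ p = ∑ a : Fin p → κ, (List.ofFn fun i => x (a i)).prod := by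
  simpa using (MultilinearMap.mkPiAlgebraFin ℕ p R).map_sum fun _ k => x k

open scoped IsMulCommutative in
theorem exists_algHom_mvPolynomial_of_commute {σ R A : Type*} [CommSemiring R] [Semiring A]
    [Algebra R A] {x : σ → A} (hx : ∀ i j, x i * x j = x j * x i) :
    ∃ Φ : MvPolynomial σ R →ₐ[R] A, Φ ∘ MvPolynomial.X = x := by
  let S := Algebra.adjoin R (Set.range x)
  have : IsMulCommutative S := Algebra.isMulCommutative_adjoin R (by
    rintro _ ⟨i, rfl⟩ _ ⟨j, rfl⟩
    exact hx i j)
  let y : σ → S := fun i => ⟨x i, Algebra.subset_adjoin ⟨i, rfl⟩⟩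
  refine ⟨S.val.comp (MvPolynomial.aeval y), funext fun i => ?_⟩
  rw [Function.comp_apply, AlgHom.comp_apply, MvPolynomial.aeval_X]
  rfl

section MatrixTensor

variable {n R S : Type*} [CommSemiring R] [Semiring S] [Algebra R S]

/-- The matrix `A ⊗ x` over an algebra `S`, for a scalar matrix `A` and `x : S`. -/
def matrixTensor : Matrix n n R →ₗ[R] S →ₗ[R] Matrix n n S :=
  LinearMap.mk₂ R (fun A x => A.map (· • x))
    (fun A B x => Matrix.ext fun i j => add_smul (A i j) (B i j) x)
    (fun r A x => Matrix.ext fun i j => smul_assoc r (A i j) x)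
    (fun A x y => Matrix.ext fun i j => smul_add (A i j) x y)
    (fun r A x => Matrix.ext fun i j => smul_comm (A i j) r x)

theorem matrixTensor_apply (A : Matrix n n R) (x : S) (i j : n) :
    matrixTensor A x i j = A i j • x := rfl

theorem map_matrixTensor {T : Type*} [Semiring T] [Algebra R T] (f : S →ₗ[R] T) (A : Matrix n n R)
    (x : S) : (matrixTensor A x).map f = matrixTensor A (f x) :=
  Matrix.ext fun i j => map_smul f (A i j) x

theorem matrixTensor_eq_smul (A : Matrix n n R) (r : R) : matrixTensor A r = r • A :=
  Matrix.ext fun i j => mul_comm (A i j) r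

theorem matrixTensor_one_one [DecidableEq n] : matrixTensor (1 : Matrix n n R) (1 : S) = 1 := by
  ext i j
  simp only [matrixTensor_apply, one_apply, ite_smul, one_smul, zero_smul]

variable [Fintype n]

theorem matrixTensor_mul (A B : Matrix n n R) (x y : S) :
    matrixTensor A x * matrixTensor B y = matrixTensor (A * B) (x * y) := by
  ext i j
  simp only [matrixTensor_apply, mul_apply, smul_mul_smul_comm, sum_smul]

theorem prod_ofFn_matrixTensor [DecidableEq n] {p : ℕ} (A : Fin p → Matrix n n R)
    (x : Fin p → S) :
    (List.ofFn fun i => matrixTensor (A i) (x i)).prod =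
      matrixTensor (List.ofFn A).prod (List.ofFn x).prod := by
  induction p with
  | zero => exact matrixTensor_one_one.symm
  | succ p ih => simp only [List.ofFn_succ, List.prod_cons, ih, matrixTensor_mul]

theorem matrixTensor_one_mulVec [DecidableEq n] (x : S) (v : n → S) (i : n) :
    (matrixTensor (1 : Matrix n n R) x *ᵥ v) i = x * v i := by
  simp [mulVec, dotProduct, matrixTensor_apply, one_apply]

theorem vecMul_matrixTensor {y : n → S} {x : S} (hx : ∀ i, x * y i = y i * x) (A : Matrix n n R) :
    y ᵥ* matrixTensor A x = matrixTensor Aᵀ x *ᵥ y := by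
  ext i
  simp only [vecMul, mulVec, dotProduct, matrixTensor_apply, transpose_apply, mul_smul_comm,
    smul_mul_assoc, hx]

end MatrixTensor

/-! ## The cubic Fierz identity -/

theorem minkowski_self_mul_self (a : Fin 11) : minkowski a a * minkowski a a = 1 := by
  unfold minkowski
  split_ifs <;> simp_all

theorem minkowski_self_ne_zero (a : Fin 11) : minkowski a a ≠ 0 :=
  left_ne_zero_of_mul_eq_one (minkowski_self_mul_self a)

/-- The factor by which `X ↦ ∑_{a < 10} Γ_a [Γ_10, X] Γ^a` acts on `Γ_J`, relative to right
multiplication by `Γ_10`. -/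
def chiralWeight (J : Finset (Fin 11)) : ℝ :=
  (1 - (-1) ^ #(J.erase 10)) * ∑ a : Fin 10, (-1) ^ #(J.erase a.castSucc)

theorem chiralWeight_eq (J : Finset (Fin 11)) :
    chiralWeight J =
      (1 - (-1) ^ #(J.erase 10)) * ((-1) ^ #J * (11 - 2 * #J) - (-1) ^ #(J.erase 10)) := by
  have hsum := sum_neg_one_pow_card_erase (R := ℝ) J
  rw [Fin.sum_univ_castSucc, Fintype.card_fin] at hsum
  rw [chiralWeight, eq_sub_of_add_eq hsum]
  rfl

theorem chiralWeight_singleton (b : Fin 10) : chiralWeight {b.castSucc} = -16 := by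
  rw [chiralWeight_eq, erase_eq_of_notMem (by simpa using (Fin.castSucc_ne_last b).symm),
    card_singleton]
  norm_num

theorem chiralWeight_pair (b : Fin 10) : chiralWeight {b.castSucc, 10} = 16 := by
  have hb : b.castSucc ≠ 10 := Fin.castSucc_ne_last b
  rw [chiralWeight_eq, erase_insert_of_ne hb, erase_singleton, card_pair hb, insert_empty_eq,
    card_singleton]
  norm_num

theorem exists_eq_of_chiralWeight_ne_zero {J : Finset (Fin 11)} (hJ : #J ≤ 5) (h3 : #J ≠ 3)
    (h4 : #J ≠ 4) (hw : chiralWeight J ≠ 0) :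
    ∃ b : Fin 10, J = {b.castSucc} ∨ J = {b.castSucc, 10} := by
  rw [chiralWeight_eq] at hw
  have hodd : Odd #(J.erase 10) := by
    by_contra heven
    exact hw (by rw [(Nat.not_odd_iff_even.1 heven).neg_one_pow, sub_self, zero_mul])
  have h5 : #J ≠ 5 := fun h5 => hw (by rw [hodd.neg_one_pow, h5]; norm_num)
  have hone : #(J.erase 10) = 1 := by
    have := pred_card_le_card_erase (s := J) (a := 10)
    have := card_erase_le (s := J) (a := 10)
    obtain ⟨k, hk⟩ := hodd
    omega
  obtain ⟨c, hc⟩ := card_eq_one.1 hone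
  have hc10 : c ≠ Fin.last 10 := (mem_erase.1 (hc ▸ mem_singleton_self c)).1
  obtain ⟨b, rfl⟩ := Fin.exists_castSucc_eq.2 hc10
  refine ⟨b, ?_⟩
  by_cases h10 : 10 ∈ J
  · right
    rw [← insert_erase h10, hc, pair_comm]
  · left
    rwa [erase_eq_of_notMem h10] at hc

theorem sum_card_le_five_eq {A : Type*} [AddCommMonoid A] (f : Finset (Fin 11) → A)
    (hf : ∀ J : Finset (Fin 11), #J ≤ 5 → (∀ b : Fin 10, J ≠ {b.castSucc} ∧
        J ≠ {b.castSucc, 10}) → f J = 0) :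
    ∑ J : {J : Finset (Fin 11) // #J ≤ 5}, f J =
      ∑ b : Fin 10, (f {b.castSucc} + f {b.castSucc, 10}) := by
  let e : Fin 10 ⊕ Fin 10 → {J : Finset (Fin 11) // #J ≤ 5} := Sum.elim
    (fun b => ⟨{b.castSucc}, by simp⟩) fun b => ⟨{b.castSucc, 10}, card_le_two.trans (by simp)⟩
  have he : Function.Injective e := by
    have h10 (b : Fin 10) : (10 : Fin 11) ≠ b.castSucc := (Fin.castSucc_ne_last b).symm
    rintro (b | b) (c | c) hbc
    · simpa [e] using hbc
    · have := congrArg (10 ∈ ·.1) hbc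
      simp [e, h10] at this
    · have := congrArg (10 ∈ ·.1) hbc
      simp [e, h10] at this
    · have := congrArg (b.castSucc ∈ ·.1) hbc
      simpa [e, (h10 _).symm] using this
  have hzero : ∀ J ∉ Set.range e, f J = 0 := fun J hJ => hf J.1 J.2 fun b =>
    ⟨fun h => hJ ⟨.inl b, Subtype.ext h.symm⟩, fun h => hJ ⟨.inr b, Subtype.ext h.symm⟩⟩
  rw [← Fintype.sum_of_injective e he (fun i => f (e i)) (fun J => f J) hzero fun _ => rfl,
    Fintype.sum_sum_type, sum_add_distrib]
  rfl

namespace MajoranaRep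

variable (M : MajoranaRep)

theorem gammaUp_eq_smul (a : Fin 11) : M.gammaUp a = minkowski a a • M.gamma a := by
  rw [gammaUp, sum_eq_single a (fun b _ hb => by simp [minkowski, hb.symm]) (by simp)]

theorem isCliffordFamily_gamma : IsCliffordFamily (fun a => minkowski a a) M.gamma where
  mul_self a := by
    have h := M.clifford a a
    rw [← two_smul ℝ, mul_smul] at h
    exact smul_right_injective _ (two_ne_zero (α := ℝ)) h
  anticomm a b hab := by
    have h := M.clifford a b
    rw [minkowski, if_neg hab, mul_zero, zero_smul] at h
    exact eq_neg_of_add_eq_zero_left h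

theorem gamma_mul_gammaUp (a : Fin 11) : M.gamma a * M.gammaUp a = 1 := by
  rw [gammaUp_eq_smul, mul_smul_comm, M.isCliffordFamily_gamma.mul_self, smul_smul,
    minkowski_self_mul_self, one_smul]

theorem gamma_ten_mul_self : M.gamma 10 * M.gamma 10 = 1 := by
  rw [M.isCliffordFamily_gamma.mul_self, minkowski, if_pos rfl, if_neg (by decide), one_smul]

theorem gamma_ten_mul (a : Fin 10) :
    M.gamma 10 * M.gamma a.castSucc = -(M.gamma a.castSucc * M.gamma 10) :=
  M.isCliffordFamily_gamma.anticomm (Fin.castSucc_ne_last a).symm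

theorem gamma_ten_mul_gammaUp (a : Fin 10) :
    M.gamma 10 * M.gammaUp a.castSucc = -(M.gammaUp a.castSucc * M.gamma 10) := by
  rw [gammaUp_eq_smul, mul_smul_comm, gamma_ten_mul, smul_neg, smul_mul_assoc]

/-- The quadratic expression `(ψ̄ A ψ)` in a spinor `y` with components in an algebra `S`, as a
linear function of `A`. -/
def quad {S : Type*} [Ring S] [Algebra ℝ S] (y : Fin 32 → S) :
    Matrix (Fin 32) (Fin 32) ℝ →ₗ[ℝ] S where
  toFun A := ∑ i, ∑ j, (M.pairing * A) i j • (y i * y j)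
  map_add' A B := by simp only [mul_add, Matrix.add_apply, add_smul, sum_add_distrib]
  map_smul' r A := by
    simp only [mul_smul_comm, Matrix.smul_apply, smul_assoc, smul_sum, RingHom.id_apply]

theorem quad_eq_dotProduct_mulVec (x : Fin 32 → ℝ) (A : Matrix (Fin 32) (Fin 32) ℝ) :
    M.quad x A = x ⬝ᵥ ((M.pairing * A) *ᵥ x) := by
  simp only [quad, LinearMap.coe_mk, AddHom.coe_mk, dotProduct, mulVec, mul_sum, smul_eq_mul]
  exact sum_congr rfl fun i _ => sum_congr rfl fun j _ => by ring

theorem quad_eq_zero {A : Matrix (Fin 32) (Fin 32) ℝ} (hA : Aᵀ * M.pairing = M.pairing * A)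
    (x : Fin 32 → ℝ) : M.quad x A = 0 := by
  rw [quad_eq_dotProduct_mulVec]
  have hskew : x ⬝ᵥ ((M.pairing * A) *ᵥ x) = -(x ⬝ᵥ ((M.pairing * A) *ᵥ x)) := by
    conv_lhs =>
      rw [dotProduct_mulVec, ← mulVec_transpose, transpose_mul, M.pairing_skew, mul_neg, hA,
        neg_mulVec, neg_dotProduct, dotProduct_comm]
  linarith

theorem quad_inv_cliffordProd_eq_zero {J : Finset (Fin 11)} (hJ : #J = 3 ∨ #J = 4)
    (x : Fin 32 → ℝ) : M.quad x (cliffordProd M.gamma J)⁻¹ = 0 := by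
  rw [M.isCliffordFamily_gamma.inv_cliffordProd minkowski_self_ne_zero, map_smul,
    M.quad_eq_zero, smul_zero]
  rw [M.isCliffordFamily_gamma.transpose_cliffordProd_mul M.gamma_skew_adjoint, Even.neg_one_pow,
    one_smul]
  rcases hJ with hJ | hJ <;> rw [hJ] <;> decide

/-- The matrix `ψ ψ̄` of a spinor `ψ`. -/
def rankOne (x : Fin 32 → ℝ) : Matrix (Fin 32) (Fin 32) ℝ := vecMulVec x (x ᵥ* M.pairing)

theorem trace_rankOne_mul (x : Fin 32 → ℝ) (A : Matrix (Fin 32) (Fin 32) ℝ) :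
    (M.rankOne x * A).trace = M.quad x A := by
  rw [rankOne, vecMulVec_mul, trace_vecMulVec, vecMul_vecMul, dotProduct_comm, ← dotProduct_mulVec,
    quad_eq_dotProduct_mulVec]

theorem rankOne_mul_mulVec (x : Fin 32 → ℝ) (A : Matrix (Fin 32) (Fin 32) ℝ) :
    (M.rankOne x * A) *ᵥ x = M.quad x A • x := by
  rw [rankOne, vecMulVec_mul, vecMulVec_mulVec, vecMul_vecMul, ← dotProduct_mulVec,
    op_smul_eq_smul, quad_eq_dotProduct_mulVec]

/-- The linear map `X ↦ ∑_{a < 10} Γ_a [Γ_10, X] Γ^a`. -/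
def chiralSum : Matrix (Fin 32) (Fin 32) ℝ →ₗ[ℝ] Matrix (Fin 32) (Fin 32) ℝ :=
  ∑ a : Fin 10, LinearMap.mulLeftRight ℝ (M.gamma a.castSucc, M.gammaUp a.castSucc) ∘ₗ
    (LinearMap.mulLeft ℝ (M.gamma 10) - LinearMap.mulRight ℝ (M.gamma 10))

theorem chiralSum_apply (X : Matrix (Fin 32) (Fin 32) ℝ) :
    M.chiralSum X = ∑ a : Fin 10,
      M.gamma a.castSucc * (M.gamma 10 * X - X * M.gamma 10) * M.gammaUp a.castSucc := by
  simp [chiralSum]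

theorem chiralSum_cliffordProd (J : Finset (Fin 11)) :
    M.chiralSum (cliffordProd M.gamma J) =
      chiralWeight J • (cliffordProd M.gamma J * M.gamma 10) := by
  set G := cliffordProd M.gamma J with hG
  have hten : M.gamma 10 * G = (-1 : ℝ) ^ #(J.erase 10) • (G * M.gamma 10) :=
    M.isCliffordFamily_gamma.mul_cliffordProd 10 J
  have hterm (a : Fin 10) : M.gamma a.castSucc * (G * M.gamma 10) * M.gammaUp a.castSucc =
      -(-1 : ℝ) ^ #(J.erase a.castSucc) • (G * M.gamma 10) := by
    rw [mul_assoc, mul_assoc G, gamma_ten_mul_gammaUp, mul_neg, mul_neg, ← mul_assoc, ← mul_assoc,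
      hG, M.isCliffordFamily_gamma.mul_cliffordProd, smul_mul_assoc, smul_mul_assoc, ← hG,
      mul_assoc G, gamma_mul_gammaUp, mul_one, neg_smul]
  rw [chiralSum_apply, hten, chiralWeight, mul_sum, sum_smul]
  refine sum_congr rfl fun a _ => ?_
  rw [mul_sub, sub_mul, mul_smul_comm, smul_mul_assoc, hterm]
  module

/-- The matrix `W = (ψ̄ Γ^a ψ) Γ_a Γ_10 + (ψ̄ Γ^a Γ_10 ψ) Γ_a`, summed over `a < 10`; the cubic
Fierz identity is `W ψ = 0`. -/
def fierzMatrix {S : Type*} [Ring S] [Algebra ℝ S] (y : Fin 32 → S) :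
    Matrix (Fin 32) (Fin 32) S :=
  ∑ a : Fin 10, (matrixTensor (M.gamma a.castSucc * M.gamma 10) (M.quad y (M.gammaUp a.castSucc)) +
    matrixTensor (M.gamma a.castSucc) (M.quad y (M.gammaUp a.castSucc * M.gamma 10)))

theorem fierzMatrix_eq_sum_smul (x : Fin 32 → ℝ) : M.fierzMatrix x = ∑ a : Fin 10,
    (M.quad x (M.gammaUp a.castSucc) • (M.gamma a.castSucc * M.gamma 10) +
      M.quad x (M.gammaUp a.castSucc * M.gamma 10) • M.gamma a.castSucc) := by
  simp only [fierzMatrix, matrixTensor_eq_smul]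

theorem chiralSum_rankOne_mulVec (x : Fin 32 → ℝ) :
    M.chiralSum (M.rankOne x) *ᵥ x = M.fierzMatrix x *ᵥ x := by
  rw [chiralSum_apply, fierzMatrix_eq_sum_smul, sum_mulVec, sum_mulVec]
  refine sum_congr rfl fun a _ => ?_
  rw [mul_sub, sub_mul, mul_assoc _ (M.rankOne x * _), mul_assoc (M.rankOne x),
    gamma_ten_mul_gammaUp, ← mul_assoc _ (M.gamma 10), mul_assoc _ (M.rankOne x), sub_mulVec,
    ← mulVec_mulVec, rankOne_mul_mulVec, ← mulVec_mulVec x _ (M.rankOne x * _),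
    rankOne_mul_mulVec, map_neg, mulVec_smul, mulVec_smul, neg_smul, sub_neg_eq_add,
    add_mulVec, smul_mulVec, smul_mulVec]

theorem cliffordProd_pair (b : Fin 10) :
    cliffordProd M.gamma {b.castSucc, 10} = M.gamma b.castSucc * M.gamma 10 := by
  rw [cliffordProd_insert, cliffordProd_singleton]
  intro c hc
  rw [mem_singleton.1 hc]
  exact Fin.castSucc_lt_last b

theorem inv_gamma (a : Fin 11) : (M.gamma a)⁻¹ = M.gammaUp a :=
  inv_eq_right_inv (M.gamma_mul_gammaUp a)

theorem inv_gamma_mul_gamma_ten (b : Fin 10) :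
    (M.gamma b.castSucc * M.gamma 10)⁻¹ = -(M.gammaUp b.castSucc * M.gamma 10) := by
  rw [← gamma_ten_mul_gammaUp]
  refine inv_eq_right_inv ?_
  rw [mul_assoc, ← mul_assoc (M.gamma 10), gamma_ten_mul_self, one_mul, gamma_mul_gammaUp]

theorem smul_chiralSum_rankOne (x : Fin 32 → ℝ) :
    (32 : ℝ) • M.chiralSum (M.rankOne x) = (-16 : ℝ) • M.fierzMatrix x := by
  have hfierz := M.isCliffordFamily_gamma.fierz minkowski_self_ne_zero (m := 5) (by simp) (by simp)
    (M.rankOne x)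
  apply_fun M.chiralSum at hfierz
  simp only [map_smul, map_sum, trace_rankOne_mul, chiralSum_cliffordProd] at hfierz
  rw [sum_card_le_five_eq fun J => M.quad x (cliffordProd M.gamma J)⁻¹ •
    chiralWeight J • (cliffordProd M.gamma J * M.gamma 10)] at hfierz
  · convert hfierz using 1
    · norm_num
    · rw [fierzMatrix_eq_sum_smul, smul_sum]
      refine sum_congr rfl fun b _ => ?_
      rw [cliffordProd_singleton, cliffordProd_pair, chiralWeight_singleton, chiralWeight_pair,
        inv_gamma, inv_gamma_mul_gamma_ten, map_neg, mul_assoc _ (M.gamma 10) (M.gamma 10),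
        gamma_ten_mul_self, mul_one]
      module
  · intro J hJ hne
    by_cases h34 : #J = 3 ∨ #J = 4
    · rw [quad_inv_cliffordProd_eq_zero M h34, zero_smul]
    · rw [not_or] at h34
      have hw : chiralWeight J = 0 := by
        by_contra hw
        obtain ⟨b, hb | hb⟩ := exists_eq_of_chiralWeight_ne_zero hJ h34.1 h34.2 hw
        exacts [(hne b).1 hb, (hne b).2 hb]
      rw [hw, zero_smul, smul_zero]

theorem fierzMatrix_mulVec_eq_zero_of_real (x : Fin 32 → ℝ) : M.fierzMatrix x *ᵥ x = 0 := by
  have h := congrArg (· *ᵥ x) (M.smul_chiralSum_rankOne x)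
  simp only [smul_mulVec, chiralSum_rankOne_mulVec] at h
  rw [← sub_eq_zero, ← sub_smul] at h
  exact (smul_eq_zero.1 h).resolve_left (by norm_num)

section CommutingSpinor

variable {S T : Type*} [Ring S] [Algebra ℝ S] [Ring T] [Algebra ℝ T]

theorem map_quad (f : S →ₐ[ℝ] T) (y : Fin 32 → S) (A : Matrix (Fin 32) (Fin 32) ℝ) :
    f (M.quad y A) = M.quad (f ∘ y) A := by
  simp only [quad, LinearMap.coe_mk, AddHom.coe_mk, map_sum, map_smul, map_mul, Function.comp_apply]

theorem map_fierzMatrix (f : S →ₐ[ℝ] T) (y : Fin 32 → S) :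
    (M.fierzMatrix y).map f = M.fierzMatrix (f ∘ y) := by
  have htensor (A : Matrix (Fin 32) (Fin 32) ℝ) (x : S) :
      f.mapMatrix (matrixTensor A x) = matrixTensor A (f x) := map_matrixTensor f.toLinearMap A x
  change f.mapMatrix (M.fierzMatrix y) = _
  simp only [fierzMatrix, map_sum, map_add, htensor, map_quad]

theorem map_fierzMatrix_mulVec (f : S →ₐ[ℝ] T) (y : Fin 32 → S) (i : Fin 32) :
    f ((M.fierzMatrix y *ᵥ y) i) = (M.fierzMatrix (f ∘ y) *ᵥ (f ∘ y)) i := by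
  rw [← map_fierzMatrix]
  exact RingHom.map_mulVec f.toRingHom _ _ i

variable {y : Fin 32 → S}

/- The components of `W ψ` are cubic polynomials in those of `ψ`, and a real polynomial vanishing at
all real points is zero. -/
theorem fierzMatrix_mulVec_eq_zero (hy : ∀ i j, y i * y j = y j * y i) :
    M.fierzMatrix y *ᵥ y = 0 := by
  have hpoly : M.fierzMatrix (MvPolynomial.X (R := ℝ)) *ᵥ MvPolynomial.X = 0 := by
    ext1 i
    refine MvPolynomial.funext fun x => ?_
    have hx : MvPolynomial.aeval x ∘ MvPolynomial.X (R := ℝ) = x :=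
      funext fun j => MvPolynomial.aeval_X x j
    have heval := M.map_fierzMatrix_mulVec (MvPolynomial.aeval x) MvPolynomial.X i
    rw [hx, fierzMatrix_mulVec_eq_zero_of_real] at heval
    simpa [MvPolynomial.aeval_eq_eval] using heval
  obtain ⟨Φ, hΦ⟩ := exists_algHom_mvPolynomial_of_commute (R := ℝ) hy
  ext1 i
  rw [← hΦ, ← map_fierzMatrix_mulVec, hpoly, Pi.zero_apply, map_zero, Pi.zero_apply]

theorem quad_mul_comm (hy : ∀ i j, y i * y j = y j * y i) (A : Matrix (Fin 32) (Fin 32) ℝ)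
    (k : Fin 32) : M.quad y A * y k = y k * M.quad y A := by
  simp only [quad, LinearMap.coe_mk, AddHom.coe_mk, sum_mul, mul_sum, smul_mul_assoc,
    mul_smul_comm, mul_assoc, hy _ k]
  simp only [← mul_assoc, hy _ k]

theorem transpose_pairing_mul_gamma (a : Fin 11) :
    (M.pairing * M.gamma a)ᵀ = M.pairing * M.gamma a := by
  rw [transpose_mul, pairing_skew, mul_neg, gamma_skew_adjoint, neg_neg]

theorem transpose_pairing_mul_gamma_mul_gamma_ten (a : Fin 10) :
    (M.pairing * (M.gamma a.castSucc * M.gamma 10))ᵀ =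
      M.pairing * (M.gamma a.castSucc * M.gamma 10) := by
  rw [← mul_assoc, transpose_mul, transpose_pairing_mul_gamma, ← mul_assoc, gamma_skew_adjoint,
    neg_mul, mul_assoc, gamma_ten_mul, mul_neg, neg_neg, mul_assoc]

theorem vecMul_pairing_mul_fierzMatrix_eq_zero (hy : ∀ i j, y i * y j = y j * y i) :
    y ᵥ* (matrixTensor M.pairing 1 * M.fierzMatrix y) = 0 := by
  have hsymm : y ᵥ* (matrixTensor M.pairing 1 * M.fierzMatrix y) =
      (matrixTensor M.pairing 1 * M.fierzMatrix y) *ᵥ y := by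
    simp only [fierzMatrix, mul_sum, mul_add, matrixTensor_mul, one_mul, vecMul_sum, vecMul_add,
      sum_mulVec, add_mulVec, vecMul_matrixTensor (M.quad_mul_comm hy _),
      transpose_pairing_mul_gamma, transpose_pairing_mul_gamma_mul_gamma_ten]
  rw [hsymm, ← mulVec_mulVec, M.fierzMatrix_mulVec_eq_zero hy, mulVec_zero]

end CommutingSpinor

end MajoranaRep

/-! ## Differentials of the flux densities -/

namespace CE

/-- The inclusion of the exterior algebra on the generators `e^a`. -/
def exteriorMap : ExteriorAlgebra ℝ (Fin 10 → ℝ) →ₐ[ℝ] CE :=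
  ExteriorAlgebra.lift ℝ ⟨Fintype.linearCombination ℝ e, fun v => by
    have hskew : Fintype.linearCombination ℝ e v * Fintype.linearCombination ℝ e v =
        -(Fintype.linearCombination ℝ e v * Fintype.linearCombination ℝ e v) := by
      simp only [Fintype.linearCombination_apply, sum_mul, mul_sum, smul_mul_smul_comm,
        ← sum_neg_distrib]
      rw [sum_comm]
      refine sum_congr rfl fun a _ => sum_congr rfl fun b _ => ?_
      rw [e_e a b, smul_neg, mul_comm]
    linear_combination (norm := module) (2⁻¹ : ℝ) • hskew⟩

theorem prod_ofFn_e_eq_exteriorMap {p : ℕ} (a : Fin p → Fin 10) :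
    (List.ofFn fun i => e (a i)).prod =
      exteriorMap (ExteriorAlgebra.ιMulti ℝ p fun i => Pi.single (a i) 1) := by
  rw [ExteriorAlgebra.ιMulti_apply, map_list_prod, List.map_ofFn]
  congr 2
  ext i
  simp [exteriorMap]

theorem prod_ofFn_e_perm {p : ℕ} (a : Fin p → Fin 10) (σ : Equiv.Perm (Fin p)) :
    (List.ofFn fun i => e (a (σ i))).prod =
      ((Equiv.Perm.sign σ : ℤ) : ℝ) • (List.ofFn fun i => e (a i)).prod := by
  rw [prod_ofFn_e_eq_exteriorMap, prod_ofFn_e_eq_exteriorMap, ← map_smul, Int.cast_smul_eq_zsmul]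
  exact congrArg exteriorMap <| (ExteriorAlgebra.ιMulti ℝ p).map_perm
    (fun i => (Pi.single (a i) 1 : Fin 10 → ℝ)) σ

theorem prod_ofFn_e_eq_zero {p : ℕ} (hp : 10 < p) (a : Fin p → Fin 10) :
    (List.ofFn fun i => e (a i)).prod = 0 := by
  obtain ⟨i, j, hij, h⟩ := Fintype.exists_ne_map_eq_of_card_lt a (by simpa using hp)
  rw [prod_ofFn_e_eq_exteriorMap,
    (ExteriorAlgebra.ιMulti ℝ p).map_eq_zero_of_eq _ (by rw [h]) hij, map_zero]

theorem prod_map_e_mul_psi (l : List (Fin 10)) (α : Fin 32) :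
    (l.map e).prod * psi α = (-1 : ℝ) ^ l.length • (psi α * (l.map e).prod) := by
  induction l with
  | nil => simp
  | cons b l ih =>
    rw [List.map_cons, List.prod_cons, mul_assoc, ih, mul_smul_comm, ← mul_assoc, e_psi,
      List.length_cons, pow_succ, mul_neg_one, neg_smul, neg_mul, smul_neg, mul_assoc]

theorem prod_ofFn_e_mul_psi {p : ℕ} (hp : Even p) (a : Fin p → Fin 10) (α : Fin 32) :
    (List.ofFn fun i => e (a i)).prod * psi α = psi α * (List.ofFn fun i => e (a i)).prod := by
  have h := prod_map_e_mul_psi (List.ofFn a) α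
  rwa [List.map_ofFn, List.length_ofFn, hp.neg_one_pow, one_smul] at h

end CE

namespace MajoranaRep

variable (M : MajoranaRep)

section Slash

variable {S : Type*} [Ring S] [Algebra ℝ S]

/-- The Feynman slash `Γ_a c^a`, summed over `a < 10`, of a family `c` of elements of an
algebra. -/
def slash (c : Fin 10 → S) : Matrix (Fin 32) (Fin 32) S :=
  ∑ a : Fin 10, matrixTensor (M.gamma a.castSucc) (c a)

theorem slash_mul_slash_add {c c' : Fin 10 → S} (hc : ∀ a b, c' b * c a = c a * c' b) :
    M.slash c * M.slash c' + M.slash c' * M.slash c = 2 •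
      matrixTensor (1 : Matrix (Fin 32) (Fin 32) ℝ)
        (∑ a : Fin 10, minkowski a.castSucc a.castSucc • (c a * c' a)) := by
  have hterm (a : Fin 10) : ∑ b : Fin 10, matrixTensor (M.gamma a.castSucc * M.gamma b.castSucc +
      M.gamma b.castSucc * M.gamma a.castSucc) (c a * c' b) =
      (2 : ℝ) • matrixTensor (1 : Matrix (Fin 32) (Fin 32) ℝ)
        (minkowski a.castSucc a.castSucc • (c a * c' a)) := by
    rw [sum_eq_single a]
    · rw [clifford, map_smul, LinearMap.smul_apply, map_smul, mul_smul]
    · intro b _ hb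
      rw [clifford, minkowski, if_neg fun h => hb (Fin.castSucc_injective _ h).symm, mul_zero,
        zero_smul, map_zero, LinearMap.zero_apply]
    · simp
  rw [slash, slash, sum_mul_sum, sum_mul_sum, sum_comm (γ := Fin 10) (s := univ) (t := univ)
      (f := fun b a => matrixTensor (M.gamma b.castSucc) (c' b) * _), map_sum,
    ← Nat.cast_smul_eq_nsmul ℝ, Nat.cast_ofNat, smul_sum, ← sum_add_distrib]
  refine sum_congr rfl fun a _ => ?_
  rw [← hterm, ← sum_add_distrib]
  refine sum_congr rfl fun b _ => ?_
  rw [matrixTensor_mul, matrixTensor_mul, hc, map_add, LinearMap.add_apply]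

theorem slash_mul_matrixTensor_one {c : Fin 10 → S} {x : S} (hx : ∀ a, c a * x = -(x * c a)) :
    M.slash c * matrixTensor (1 : Matrix (Fin 32) (Fin 32) ℝ) x =
      -(matrixTensor (1 : Matrix (Fin 32) (Fin 32) ℝ) x * M.slash c) := by
  simp only [slash, sum_mul, mul_sum, matrixTensor_mul, mul_one, one_mul, hx, map_neg,
    sum_neg_distrib]

theorem gamma_ten_mul_slash (c : Fin 10 → S) :
    matrixTensor (M.gamma 10) 1 * M.slash c = -(M.slash c * matrixTensor (M.gamma 10) 1) := by
  simp only [slash, sum_mul, mul_sum, matrixTensor_mul, mul_one, one_mul, gamma_ten_mul, map_neg,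
    LinearMap.neg_apply, sum_neg_distrib]

theorem gamma_ten_mul_slash_pow (c : Fin 10 → S) {p : ℕ} (hp : Odd p) :
    matrixTensor (M.gamma 10) 1 * M.slash c ^ p =
      -(M.slash c ^ p * matrixTensor (M.gamma 10) 1) := by
  have hsemi : SemiconjBy (matrixTensor (M.gamma 10) (1 : S)) (M.slash c) (-M.slash c) := by
    rw [SemiconjBy, gamma_ten_mul_slash, neg_mul]
  have hpow := hsemi.pow_right p
  rwa [SemiconjBy, hp.neg_pow, neg_mul] at hpow

theorem slash_pow (c : Fin 10 → S) (p : ℕ) :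
    M.slash c ^ p = ∑ a : Fin p → Fin 10,
      matrixTensor (List.ofFn fun i => M.gamma (a i).castSucc).prod
        (List.ofFn fun i => c (a i)).prod := by
  rw [slash, sum_pow_eq_sum_prod_ofFn]
  exact sum_congr rfl fun a _ => prod_ofFn_matrixTensor _ _

theorem fierzMatrix_eq_slash (y : Fin 32 → S) :
    M.fierzMatrix y =
      M.slash (fun a => M.quad y (M.gammaUp a.castSucc)) * matrixTensor (M.gamma 10) 1 +
        M.slash fun a => M.quad y (M.gammaUp a.castSucc * M.gamma 10) := by
  simp only [fierzMatrix, slash, sum_mul, matrixTensor_mul, mul_one, sum_add_distrib]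

end Slash

open CE

theorem bilinear_eq_quad (A : Matrix (Fin 32) (Fin 32) ℝ) : M.bilinear A = M.quad psi A := rfl

theorem mul_bilinear_comm (x : CE) (A : Matrix (Fin 32) (Fin 32) ℝ) :
    x * M.bilinear A = M.bilinear A * x := by
  induction x using CE.induction with
  | halg r => exact Algebra.commutes r _
  | hgen x =>
    cases x with
    | psi α => exact M.psi_bilinear α A
    | e a => exact M.e_bilinear a A
  | hadd x y hx hy => rw [add_mul, mul_add, hx, hy]
  | hmul x y hx hy => rw [mul_assoc, hy, ← mul_assoc, hx, mul_assoc]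

/-- The matrix-valued form `E = Γ_a e^a`. -/
def vielbeinMatrix : Matrix (Fin 32) (Fin 32) CE := M.slash e

/-- The matrix-valued form `V = Γ_a (ψ̄ Γ^a ψ)`, which is the differential of `E = Γ_a e^a`. -/
def torsionMatrix : Matrix (Fin 32) (Fin 32) CE :=
  M.slash fun a => M.bilinear (M.gammaUp a.castSucc)

/-- The matrix-valued form `H = Γ_a (ψ̄ Γ^a Γ_10 ψ)`, whose anticommutator with `E = Γ_a e^a` is
`2 H_3^A`. -/
def chiralTorsionMatrix : Matrix (Fin 32) (Fin 32) CE :=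
  M.slash fun a => M.bilinear (M.gammaUp a.castSucc * M.gamma 10)

theorem fierzMatrix_psi : M.fierzMatrix psi =
    M.torsionMatrix * matrixTensor (M.gamma 10) 1 + M.chiralTorsionMatrix :=
  M.fierzMatrix_eq_slash psi

theorem e_mul_sum_bilinear_mul_e (r : Fin 10 → ℝ) (A : Fin 10 → Matrix (Fin 32) (Fin 32) ℝ)
    (b : Fin 10) :
    e b * ∑ a, r a • (M.bilinear (A a) * e a) = -((∑ a, r a • (M.bilinear (A a) * e a)) * e b) := by
  rw [mul_sum, sum_mul, ← sum_neg_distrib]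
  refine sum_congr rfl fun a _ => ?_
  rw [mul_smul_comm, smul_mul_assoc, ← mul_assoc, mul_bilinear_comm, mul_assoc, mul_assoc, e_e b a,
    mul_neg, smul_neg]

theorem exists_torsionMatrix_anticommutator : ∃ C : Matrix (Fin 32) (Fin 32) CE,
    M.torsionMatrix * M.vielbeinMatrix + M.vielbeinMatrix * M.torsionMatrix = 2 • C ∧
      M.vielbeinMatrix * C = -(C * M.vielbeinMatrix) :=
  ⟨_, M.slash_mul_slash_add fun _ _ => M.mul_bilinear_comm _ _,
    M.slash_mul_matrixTensor_one (M.e_mul_sum_bilinear_mul_e _ _)⟩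

theorem H3A_eq_sum_gammaUp : M.H3A = ∑ a : Fin 10, minkowski a.castSucc a.castSucc •
    (M.bilinear (M.gammaUp a.castSucc * M.gamma 10) * e a) := by
  refine sum_congr rfl fun a _ => ?_
  simp only [bilinear_eq_quad]
  rw [gammaUp_eq_smul, smul_mul_assoc, map_smul, smul_mul_assoc, smul_smul,
    minkowski_self_mul_self, one_smul]

theorem chiralTorsionMatrix_anticommutator :
    M.chiralTorsionMatrix * M.vielbeinMatrix + M.vielbeinMatrix * M.chiralTorsionMatrix =
      2 • matrixTensor (1 : Matrix (Fin 32) (Fin 32) ℝ) M.H3A := by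
  rw [H3A_eq_sum_gammaUp]
  exact M.slash_mul_slash_add fun _ _ => M.mul_bilinear_comm _ _

theorem vielbeinMatrix_mul_H3A :
    M.vielbeinMatrix * matrixTensor (1 : Matrix (Fin 32) (Fin 32) ℝ) M.H3A =
      -(matrixTensor (1 : Matrix (Fin 32) (Fin 32) ℝ) M.H3A * M.vielbeinMatrix) := by
  refine M.slash_mul_matrixTensor_one fun a => ?_
  rw [H3A_eq_sum_gammaUp]
  exact M.e_mul_sum_bilinear_mul_e _ _ a

theorem H3A_mul_psi (α : Fin 32) : M.H3A * psi α = -(psi α * M.H3A) := by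
  rw [H3A, mul_sum, sum_mul, ← sum_neg_distrib]
  refine sum_congr rfl fun a _ => ?_
  rw [mul_assoc, e_psi, mul_neg, ← mul_assoc, ← mul_assoc, mul_bilinear_comm]

theorem vielbeinMatrix_pow_eq_zero {p : ℕ} (hp : 10 < p) : M.vielbeinMatrix ^ p = 0 := by
  rw [vielbeinMatrix, slash_pow]
  exact sum_eq_zero fun a _ => by rw [prod_ofFn_e_eq_zero hp, map_zero]

theorem mapMatrix_d_mul (X Y : Matrix (Fin 32) (Fin 32) CE) : M.d.mapMatrix (X * Y) =
    M.d.mapMatrix X * Y + parity.mapMatrix X * M.d.mapMatrix Y := by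
  ext i j
  simp [mul_apply, map_sum, d_mul, sum_add_distrib]

theorem mapMatrix_d_matrixTensor (A : Matrix (Fin 32) (Fin 32) ℝ) (x : CE) :
    M.d.mapMatrix (matrixTensor A x) = matrixTensor A (M.d x) := map_matrixTensor M.d A x

theorem mapMatrix_d_matrixTensor_one (A : Matrix (Fin 32) (Fin 32) ℝ) :
    M.d.mapMatrix (matrixTensor A 1) = 0 := by
  rw [mapMatrix_d_matrixTensor, ← map_one (algebraMap ℝ CE), d_algebraMap, map_zero]

theorem mapMatrix_d_mul_matrixTensor_one (X : Matrix (Fin 32) (Fin 32) CE)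
    (A : Matrix (Fin 32) (Fin 32) ℝ) :
    M.d.mapMatrix (X * matrixTensor A 1) = M.d.mapMatrix X * matrixTensor A 1 := by
  rw [mapMatrix_d_mul, mapMatrix_d_matrixTensor_one, mul_zero, add_zero]

theorem mapMatrix_parity_matrixTensor (A : Matrix (Fin 32) (Fin 32) ℝ) (x : CE) :
    parity.mapMatrix (matrixTensor A x) = matrixTensor A (parity x) :=
  map_matrixTensor parity.toLinearMap A x

theorem mapMatrix_d_matrixTensor_one_mul (A : Matrix (Fin 32) (Fin 32) ℝ)
    (X : Matrix (Fin 32) (Fin 32) CE) :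
    M.d.mapMatrix (matrixTensor A 1 * X) = matrixTensor A 1 * M.d.mapMatrix X := by
  rw [mapMatrix_d_mul, mapMatrix_d_matrixTensor_one, zero_mul, zero_add,
    mapMatrix_parity_matrixTensor, map_one]

theorem mapMatrix_d_vielbeinMatrix : M.d.mapMatrix M.vielbeinMatrix = M.torsionMatrix := by
  simp only [vielbeinMatrix, torsionMatrix, slash, map_sum, mapMatrix_d_matrixTensor, d_e]

theorem mapMatrix_parity_vielbeinMatrix :
    parity.mapMatrix M.vielbeinMatrix = -M.vielbeinMatrix := by
  simp only [vielbeinMatrix, slash, map_sum, mapMatrix_parity_matrixTensor, e, parity_gen, map_neg,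
    sum_neg_distrib]

theorem mapMatrix_d_vielbeinMatrix_pow (k : ℕ) :
    M.d.mapMatrix (M.vielbeinMatrix ^ (2 * k + 2)) =
      (k + 1) • (M.torsionMatrix * M.vielbeinMatrix ^ (2 * k + 1) -
        M.vielbeinMatrix ^ (2 * k + 1) * M.torsionMatrix) := by
  obtain ⟨C, hV, hC⟩ := M.exists_torsionMatrix_anticommutator
  exact skewDerivation_even_pow hV hC (τ := parity.mapMatrix.toRingHom) M.mapMatrix_d_mul
    M.mapMatrix_parity_vielbeinMatrix M.mapMatrix_d_vielbeinMatrix k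

/-- The element `(ψ̄ X ψ) = ψ^α η_{αβ} X^β_γ ψ^γ` for a matrix `X` of forms. The entries of `X`
stand between the two spinors, which matters for the signs since `e^a` anticommutes with `ψ^α`. -/
def sandwich : Matrix (Fin 32) (Fin 32) CE →ₗ[ℝ] CE where
  toFun X := psi ⬝ᵥ ((matrixTensor M.pairing 1 * X) *ᵥ psi)
  map_add' X Y := by rw [mul_add, add_mulVec, dotProduct_add]
  map_smul' r X := by rw [mul_smul_comm, smul_mulVec, dotProduct_smul, RingHom.id_apply]

theorem sandwich_apply (X : Matrix (Fin 32) (Fin 32) CE) :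
    M.sandwich X = psi ⬝ᵥ ((matrixTensor M.pairing 1 * X) *ᵥ psi) := rfl

theorem sandwich_matrixTensor {w : CE} (hw : ∀ α, w * psi α = psi α * w)
    (A : Matrix (Fin 32) (Fin 32) ℝ) : M.sandwich (matrixTensor A w) = M.bilinear A * w := by
  simp only [sandwich_apply, matrixTensor_mul, one_mul, dotProduct, mulVec, matrixTensor_apply,
    bilinear, mul_sum, sum_mul, smul_mul_assoc, mul_smul_comm, hw, mul_assoc]

theorem sandwich_mul_fierzMatrix (X : Matrix (Fin 32) (Fin 32) CE) :
    M.sandwich (X * M.fierzMatrix psi) = 0 := by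
  rw [sandwich_apply, ← mul_assoc, ← mulVec_mulVec, fierzMatrix_mulVec_eq_zero M psi_psi,
    mulVec_zero, dotProduct_zero]

theorem sandwich_fierzMatrix_mul (X : Matrix (Fin 32) (Fin 32) CE) :
    M.sandwich (M.fierzMatrix psi * X) = 0 := by
  rw [sandwich_apply, ← mul_assoc, ← mulVec_mulVec, dotProduct_mulVec,
    vecMul_pairing_mul_fierzMatrix_eq_zero M psi_psi, zero_dotProduct]

theorem mul_sandwich {x : CE} (hx : ∀ α, x * psi α = -(psi α * x))
    (X : Matrix (Fin 32) (Fin 32) CE) :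
    x * M.sandwich X = -M.sandwich (matrixTensor (1 : Matrix (Fin 32) (Fin 32) ℝ) x * X) := by
  have hcomm : matrixTensor M.pairing 1 * (matrixTensor (1 : Matrix (Fin 32) (Fin 32) ℝ) x * X) =
      matrixTensor (1 : Matrix (Fin 32) (Fin 32) ℝ) x * (matrixTensor M.pairing 1 * X) := by
    rw [← mul_assoc, ← mul_assoc, matrixTensor_mul, matrixTensor_mul, mul_one, one_mul, mul_one,
      one_mul]
  rw [sandwich_apply, sandwich_apply, hcomm,
    ← mulVec_mulVec psi (matrixTensor (1 : Matrix (Fin 32) (Fin 32) ℝ) x)]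
  simp only [dotProduct, mul_sum, matrixTensor_one_mulVec, ← sum_neg_distrib]
  exact sum_congr rfl fun α _ => by rw [← mul_assoc, hx, neg_mul, mul_assoc]

theorem d_sandwich (X : Matrix (Fin 32) (Fin 32) CE) :
    M.d (M.sandwich X) = -M.sandwich (M.d.mapMatrix X) := by
  have hpsi (α : Fin 32) : parity (psi α) = -psi α := parity_gen _
  rw [sandwich_apply, sandwich_apply, ← mapMatrix_d_matrixTensor_one_mul]
  simp only [dotProduct, mulVec, map_sum, d_mul, d_psi, hpsi, LinearMap.mapMatrix_apply, map_apply,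
    zero_mul, mul_zero, add_zero, zero_add, neg_mul, sum_neg_distrib]

theorem sandwich_vielbeinMatrix_pow_mul {p : ℕ} (hp : Even p) (A : Matrix (Fin 32) (Fin 32) ℝ) :
    M.sandwich (M.vielbeinMatrix ^ p * matrixTensor A 1) = ∑ a : Fin p → Fin 10,
      M.bilinear ((List.ofFn fun i => M.gamma (a i).castSucc).prod * A) *
        (List.ofFn fun i => e (a i)).prod := by
  simp only [vielbeinMatrix, slash_pow, sum_mul, matrixTensor_mul, mul_one, map_sum,
    M.sandwich_matrixTensor (prod_ofFn_e_mul_psi hp _)]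

theorem sum_bilinear_prod_perm_mul {p : ℕ} (A : Matrix (Fin 32) (Fin 32) ℝ)
    (σ : Equiv.Perm (Fin p)) :
    ∑ a : Fin p → Fin 10, ((Equiv.Perm.sign σ : ℤ) : ℝ) •
      (M.bilinear ((List.ofFn fun i => M.gamma (a (σ i)).castSucc).prod * A) *
        (List.ofFn fun i => e (a i)).prod) =
    ∑ a : Fin p → Fin 10, M.bilinear ((List.ofFn fun i => M.gamma (a i).castSucc).prod * A) *
      (List.ofFn fun i => e (a i)).prod := by
  rw [← (Equiv.arrowCongr σ (Equiv.refl (Fin 10))).symm.sum_comp fun a => _ * _]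
  refine sum_congr rfl fun a _ => ?_
  simp only [Equiv.arrowCongr_symm, Equiv.arrowCongr_apply, Equiv.symm_symm, Equiv.refl_symm,
    Equiv.coe_refl, Function.comp_apply, id_eq]
  rw [prod_ofFn_e_perm, mul_smul_comm]

theorem flux_eq_sandwich {p : ℕ} (hp : Even p) (A : Matrix (Fin 32) (Fin 32) ℝ) :
    M.flux p A =
      (p.factorial : ℝ)⁻¹ • M.sandwich (M.vielbeinMatrix ^ p * matrixTensor A 1) := by
  have hskew (a : Fin p → Fin 10) : M.bilinear (M.gammaSkew (fun i => (a i).castSucc) * A) =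
      (p.factorial : ℝ)⁻¹ • ∑ σ : Equiv.Perm (Fin p), ((Equiv.Perm.sign σ : ℤ) : ℝ) •
        M.bilinear ((List.ofFn fun i => M.gamma (a (σ i)).castSucc).prod * A) := by
    simp only [bilinear_eq_quad, gammaSkew, smul_mul_assoc, sum_mul, map_smul, map_sum]
  simp only [flux, hskew, smul_mul_assoc, sum_mul, ← smul_sum]
  rw [sum_comm]
  simp only [sum_bilinear_prod_perm_mul, ← sandwich_vielbeinMatrix_pow_mul M hp]
  rw [sum_const, card_univ, Fintype.card_perm, Fintype.card_fin, ← Nat.cast_smul_eq_nsmul ℝ,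
    inv_smul_smul₀ (by positivity)]

theorem d_flux (k : ℕ) (A : Matrix (Fin 32) (Fin 32) ℝ) :
    M.d (M.flux (2 * k + 2) A) = -(2 * (2 * k + 1).factorial : ℝ)⁻¹ •
      M.sandwich ((M.torsionMatrix * M.vielbeinMatrix ^ (2 * k + 1) -
        M.vielbeinMatrix ^ (2 * k + 1) * M.torsionMatrix) * matrixTensor A 1) := by
  rw [M.flux_eq_sandwich (by simp [parity_simps]), map_smul, d_sandwich,
    mapMatrix_d_mul_matrixTensor_one, mapMatrix_d_vielbeinMatrix_pow, smul_mul_assoc, map_nsmul,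
    ← Nat.cast_smul_eq_nsmul ℝ, ← neg_smul, smul_smul, Nat.factorial_succ (2 * k + 1)]
  congr 1
  push_cast
  field_simp
  ring

theorem H3A_mul_flux (k : ℕ) (A : Matrix (Fin 32) (Fin 32) ℝ) :
    M.H3A * M.flux (2 * k) A = -(2 * (2 * k + 1).factorial : ℝ)⁻¹ •
      M.sandwich ((M.chiralTorsionMatrix * M.vielbeinMatrix ^ (2 * k + 1) +
        M.vielbeinMatrix ^ (2 * k + 1) * M.chiralTorsionMatrix) * matrixTensor A 1) := by
  rw [M.flux_eq_sandwich (even_two_mul k), mul_smul_comm, M.mul_sandwich M.H3A_mul_psi,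
    mul_odd_pow_add_odd_pow_mul M.chiralTorsionMatrix_anticommutator M.vielbeinMatrix_mul_H3A,
    smul_mul_assoc, map_nsmul, ← Nat.cast_smul_eq_nsmul ℝ, mul_assoc, smul_neg, neg_smul, smul_smul,
    Nat.factorial_succ]
  congr 2
  push_cast
  field_simp
  ring

theorem sandwich_torsionMatrix_commutator {X : Matrix (Fin 32) (Fin 32) CE}
    (hX : matrixTensor (M.gamma 10) 1 * X = -(X * matrixTensor (M.gamma 10) 1)) :
    M.sandwich (M.torsionMatrix * X - X * M.torsionMatrix) =
      M.sandwich ((M.chiralTorsionMatrix * X + X * M.chiralTorsionMatrix) *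
        matrixTensor (M.gamma 10) 1) := by
  have hten : matrixTensor (M.gamma 10) (1 : CE) * matrixTensor (M.gamma 10) 1 = 1 := by
    rw [matrixTensor_mul, gamma_ten_mul_self, mul_one, matrixTensor_one_one]
  have hV : matrixTensor (M.gamma 10) 1 * M.torsionMatrix =
      -(M.torsionMatrix * matrixTensor (M.gamma 10) 1) := M.gamma_ten_mul_slash _
  have hH : matrixTensor (M.gamma 10) 1 * M.chiralTorsionMatrix =
      -(M.chiralTorsionMatrix * matrixTensor (M.gamma 10) 1) := M.gamma_ten_mul_slash _
  rw [commutator_eq_anticommutator_mul_add hten hV hH hX, ← fierzMatrix_psi, map_add,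
    map_add _ (M.fierzMatrix psi * _), sandwich_mul_fierzMatrix, sandwich_fierzMatrix_mul, add_zero,
    add_zero]

theorem sandwich_torsionMatrix_commutator_mul {X : Matrix (Fin 32) (Fin 32) CE}
    (hX : matrixTensor (M.gamma 10) 1 * X = -(X * matrixTensor (M.gamma 10) 1)) :
    M.sandwich ((M.torsionMatrix * X - X * M.torsionMatrix) * matrixTensor (M.gamma 10) 1) =
      M.sandwich (M.chiralTorsionMatrix * X + X * M.chiralTorsionMatrix) := by
  rw [commutator_mul_eq_anticommutator_sub hX, ← fierzMatrix_psi, map_sub,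
    map_add _ (M.fierzMatrix psi * _), sandwich_mul_fierzMatrix, sandwich_fierzMatrix_mul, add_zero,
    sub_zero]

theorem d_flux_one (k : ℕ) :
    M.d (M.flux (2 * k + 2) 1) = M.H3A * M.flux (2 * k) (M.gamma 10) := by
  rw [d_flux, H3A_mul_flux, matrixTensor_one_one, mul_one, sandwich_torsionMatrix_commutator]
  exact M.gamma_ten_mul_slash_pow _ (odd_two_mul_add_one k)

theorem d_flux_gamma_ten (k : ℕ) :
    M.d (M.flux (2 * k + 2) (M.gamma 10)) = M.H3A * M.flux (2 * k) 1 := by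
  rw [d_flux, H3A_mul_flux, matrixTensor_one_one, mul_one, sandwich_torsionMatrix_commutator_mul]
  exact M.gamma_ten_mul_slash_pow _ (odd_two_mul_add_one k)

theorem H3A_mul_flux_eq_zero {k : ℕ} (hk : 5 ≤ k) (A : Matrix (Fin 32) (Fin 32) ℝ) :
    M.H3A * M.flux (2 * k) A = 0 := by
  rw [H3A_mul_flux, M.vielbeinMatrix_pow_eq_zero (by omega), mul_zero, zero_mul, add_zero, zero_mul,
    map_zero, smul_zero]

end MajoranaRep

end SuperIIA

end

theorem mainTheorem10 (M : SuperIIA.MajoranaRep) :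
    M.d M.F8 = M.H3A * M.F6 ∧
    M.d M.F10 = M.H3A * M.F8 ∧
    M.d M.F12 = M.H3A * M.F10 ∧
    M.H3A * M.F12 = 0 :=
  ⟨M.d_flux_one 2, M.d_flux_gamma_ten 3, M.d_flux_one 4, M.H3A_mul_flux_eq_zero le_rfl 1⟩
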